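/- Let $\mathcal K_x>0$, let $\mathcal K_x^*=\operatorname{arctanh}e^{-2\mathcal K_x}$ be the dual coupling and assume $\mathcal K_x^*<\mathcal K_y$ (ferromagnetic region). Put $\alpha=\tanh\mathcal K_x^*\coth\mathcal K_y$, $\beta=\tanh\mathcal K_x^*\tanh\mathcal K_y$, and for real $\theta$ define $\gamma_\theta\ge 0$ and $b_\theta$ by $$\cosh\gamma_\theta=\cosh2\mathcal K_x^*\cosh2\mathcal K_y-\sinh2\mathcal K_x^*\sinh2\mathcal K_y\cos\theta,\qquad b_\theta=\sqrt{\frac{(1-\alpha e^{i\theta})(1-\beta e^{-i\theta})}{(1-\beta e^{i\theta})(1-\alpha e^{-i\theta})}},$$ where square roots of complex numbers here and below are the branches with positive real part. Let $N\ge1$ and $l$ be integers, $\boldsymbol\theta_p=\{\frac{2\pi j}{N}: 0\le j<N\}$, $\boldsymbol\theta_a=\{\frac{(2j+1)\pi}{N}:0\le j<N\}$. Define $N\times N$ matrices with rows indexed by $\theta\in\boldsymbol\theta_p$ and columns by $\theta'\in\boldsymbol\theta_a$: $$D_{\theta,\theta'}=\frac{e^{-i(l-\frac12)(\theta-\theta')}}{2iN\sin\frac{\theta'-\theta}{2}}\left(\sqrt{\frac{b_{\theta'}}{b_\theta}}+\sqrt{\frac{b_\theta}{b_{\theta'}}}\right),\qquad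 \bar B_{\theta,\theta'}=C_{\theta,\theta'}=\frac{e^{-i(l-\frac12)(\theta+\theta')}}{2iN\sin\frac{\theta+\theta'}{2}}\left(\sqrt{b_\theta b_{\theta'}}-\frac1{\sqrt{b_\theta b_{\theta'}}}\right).$$ Let $\mathrm{sn},\mathrm{cn},\mathrm{dn}$ be the Jacobi elliptic functions of modulus $k=\sinh2\mathcal K_x^*/\sinh2\mathcal K_y\in(0,1)$, and $K,K'$ the complete elliptic integrals of the first kind of moduli $k$ and $\sqrt{1-k^2}$. Then there is a unique $\eta\in(-K'/2,0)$ with $\sinh2\mathcal K_x=i\,\mathrm{sn}(2i\eta)$, and for every $\theta\in[0,2\pi)$ there is a unique $u_\theta\in[-K,K)$ with $$\frac{\mathrm{sn}(u_\theta+i\eta)}{\mathrm{sn}(u_\theta-i\eta)}=e^{i\theta},\qquad \frac{1}{k\,\mathrm{sn}(u_\theta+i\eta)\,\mathrm{sn}(u_\theta-i\eta)}=e^{\gamma_\theta}.$$ For all $\theta,\theta'\in[0,2\pi)$ with $\theta\pm\theta'\ne0,2\pi$, $$\frac{1}{2\sin\frac{\theta-\theta'}{2}}\left(\sqrt{\frac{b_\theta}{b_{\theta'}}}+\sqrt{\frac{b_{\theta'}}{b_\theta}}\right)=\frac{\sinh2\mathcal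 K_y}{\sqrt{\sinh\gamma_\theta\sinh\gamma_{\theta'}}}\,\frac{\mathrm{dn}(u_\theta-u_{\theta'})}{\mathrm{sn}(u_\theta-u_{\theta'})},$$ $$\frac{1}{2\sin\frac{\theta+\theta'}{2}}\left(\sqrt{b_\theta b_{\theta'}}-\frac{1}{\sqrt{b_\theta b_{\theta'}}}\right)=\frac{-i\sinh2\mathcal K_x^*}{\sqrt{\sinh\gamma_\theta\sinh\gamma_{\theta'}}}\,\mathrm{cn}(u_\theta-u_{\theta'}).$$ Let $\Phi_{\theta,\theta'}=\dfrac{\mathrm{dn}(u_\theta-u_{\theta'})}{\mathrm{sn}(u_\theta-u_{\theta'})}$ and $\Psi_{\theta,\theta'}=\mathrm{cn}(u_\theta-u_{\theta'})$ for $\theta\in\boldsymbol\theta_p$, $\theta'\in\boldsymbol\theta_a$, and let $\Lambda_\nu$ $(\nu=a,p)$ be the diagonal matrix with entries $e^{i(l-\frac12)\theta}/\sqrt{\sinh\gamma_\theta}$, $\theta\in\boldsymbol\theta_\nu$; bars denote entrywise complex conjugation. Then $D$ and $\Phi$ are invertible and $$D^{-1}=\frac{-iN}{\sinh2\mathcal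 K_y}\,\Lambda_a^{-1}\Phi^{-1}\bar\Lambda_p^{-1},\qquad BD^{-1}=i\,\frac{\sinh2\mathcal K_x^*}{\sinh2\mathcal K_y}\,\Lambda_p\Psi\Phi^{-1}\bar\Lambda_p^{-1},\qquad D^{-1}C=i\,\frac{\sinh2\mathcal K_x^*}{\sinh2\mathcal K_y}\,\Lambda_a^{-1}\Phi^{-1}\Psi\bar\Lambda_a,$$ $$|\det D|=\frac{(\sinh2\mathcal K_y)^N\,|\det\Phi|}{N^N\sqrt{\prod_{\theta\in\boldsymbol\theta_p}\sinh\gamma_\theta\prod_{\theta\in\boldsymbol\theta_a}\sinh\gamma_\theta}}.$$ -/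

import Mathlib

noncomputable section

namespace Ising

open Real Complex Matrix

/-! ### Jacobi elliptic functions of modulus `k` -/

/-- Incomplete elliptic integral of the first kind in amplitude form,
`F(φ, k) = ∫₀^φ dt / √(1 - k² sin² t)`. -/
def ellipticF (k φ : ℝ) : ℝ := ∫ t in (0 : ℝ)..φ, 1 / √(1 - k ^ 2 * Real.sin t ^ 2)

/-- Complete elliptic integral of the first kind,
`K(k) = ∫₀¹ dt / √((1 - t²)(1 - k² t²))`. -/
def ellipticK (k : ℝ) : ℝ := ∫ t in (0 : ℝ)..1, 1 / √((1 - t ^ 2) * (1 - k ^ 2 * t ^ 2))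

/-- The amplitude `am(u, k)`: the inverse function of `φ ↦ F(φ, k)`, which for `|k| < 1` is an
increasing bijection of `ℝ`. -/
def am (k : ℝ) : ℝ → ℝ := Function.invFun (ellipticF k)

/-- The Jacobi function `sn(u, k)` of a real argument. -/
def sn (k u : ℝ) : ℝ := Real.sin (am k u)

/-- The Jacobi function `cn(u, k)` of a real argument. -/
def cn (k u : ℝ) : ℝ := Real.cos (am k u)

/-- The Jacobi function `dn(u, k)` of a real argument. -/
def dn (k u : ℝ) : ℝ := √(1 - k ^ 2 * sn k u ^ 2)

/-- The Jacobi function `sn(x + iy, k)` of a complex argument, i.e. the meromorphic continuation of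
the real `sn`, written (as usual) through its real and imaginary parts: with `s, c, d` the values
of `sn, cn, dn` at `x` for the modulus `k` and `s₁, c₁, d₁` their values at `y` for the
complementary modulus `k' = √(1 - k²)`,
`sn(x + iy) = (s d₁ + i c d s₁ c₁) / (c₁² + k² s² s₁²)`.
The poles are the zeros of the denominator. The facts `snC_ofReal` and `differentiableAt_snC` below
confirm that this function extends the real `sn` and is holomorphic off its poles. -/
def snC (k : ℝ) (z : ℂ) : ℂ :=
  let s := sn k z.re
  let c := cn k z.re
  let d := dn k z.re
  let s₁ := sn (√(1 - k ^ 2)) z.im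
  let c₁ := cn (√(1 - k ^ 2)) z.im
  let d₁ := dn (√(1 - k ^ 2)) z.im
  ((s * d₁ : ℝ) + I * (c * d * s₁ * c₁ : ℝ)) / ((c₁ ^ 2 + k ^ 2 * s ^ 2 * s₁ ^ 2 : ℝ) : ℂ)

theorem radicand_pos {k : ℝ} (hk : k ^ 2 < 1) (t : ℝ) : 0 < 1 - k ^ 2 * Real.sin t ^ 2 := by
  nlinarith [Real.sin_sq_le_one t, sq_nonneg (Real.sin t), sq_nonneg k]

theorem continuous_integrand {k : ℝ} (hk : k ^ 2 < 1) :
    Continuous fun t : ℝ => 1 / √(1 - k ^ 2 * Real.sin t ^ 2) :=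
  continuous_const.div (by fun_prop) fun t => (Real.sqrt_pos.2 (radicand_pos hk t)).ne'

theorem hasDerivAt_ellipticF {k : ℝ} (hk : k ^ 2 < 1) (φ : ℝ) :
    HasDerivAt (ellipticF k) (1 / √(1 - k ^ 2 * Real.sin φ ^ 2)) φ :=
  (continuous_integrand hk).integral_hasStrictDerivAt 0 φ |>.hasDerivAt

theorem strictMono_ellipticF {k : ℝ} (hk : k ^ 2 < 1) : StrictMono (ellipticF k) :=
  strictMono_of_deriv_pos fun φ => by
    rw [(hasDerivAt_ellipticF hk φ).deriv]
    exact one_div_pos.2 (Real.sqrt_pos.2 (radicand_pos hk φ))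

theorem le_ellipticF {k : ℝ} (hk : k ^ 2 < 1) {a b : ℝ} (hab : a ≤ b) :
    b - a ≤ ellipticF k b - ellipticF k a := by
  have hmono : Monotone fun φ => ellipticF k φ - φ := by
    refine monotone_of_deriv_nonneg
      (fun φ => ((hasDerivAt_ellipticF hk φ).sub (hasDerivAt_id φ)).differentiableAt) fun φ => ?_
    have h : deriv (fun φ => ellipticF k φ - φ) φ = 1 / √(1 - k ^ 2 * Real.sin φ ^ 2) - 1 :=
      ((hasDerivAt_ellipticF hk φ).sub (hasDerivAt_id φ)).deriv
    rw [h, sub_nonneg, le_div_iff₀ (Real.sqrt_pos.2 (radicand_pos hk φ)), one_mul]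
    exact Real.sqrt_le_one.2 (by nlinarith [mul_nonneg (sq_nonneg k) (sq_nonneg (Real.sin φ))])
  have := hmono hab
  simp only at this
  linarith

theorem surjective_ellipticF {k : ℝ} (hk : k ^ 2 < 1) : Function.Surjective (ellipticF k) := by
  have hc : Continuous (ellipticF k) :=
    continuous_iff_continuousAt.2 fun φ => (hasDerivAt_ellipticF hk φ).continuousAt
  have h0 : ellipticF k 0 = 0 := by simp [ellipticF]
  refine hc.surjective ?_ ?_
  · refine Filter.tendsto_atTop_mono' _ ?_ Filter.tendsto_id
    filter_upwards [Filter.eventually_ge_atTop 0] with x hx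
    have := le_ellipticF hk hx
    simp only [id]; linarith
  · refine Filter.tendsto_atBot_mono' _ ?_ Filter.tendsto_id
    filter_upwards [Filter.eventually_le_atBot 0] with x hx
    have := le_ellipticF hk hx
    simp only [id]; linarith

theorem ellipticF_am {k : ℝ} (hk : k ^ 2 < 1) (u : ℝ) : ellipticF k (am k u) = u :=
  Function.invFun_eq (surjective_ellipticF hk u)

theorem am_zero {k : ℝ} (hk : k ^ 2 < 1) : am k 0 = 0 :=
  (strictMono_ellipticF hk).injective (by rw [ellipticF_am hk]; simp [ellipticF])

theorem dn_pos {k : ℝ} (hk : k ^ 2 < 1) (u : ℝ) : 0 < dn k u :=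
  Real.sqrt_pos.2 (radicand_pos hk _)

theorem hasDerivAt_am {k : ℝ} (hk : k ^ 2 < 1) (u : ℝ) : HasDerivAt (am k) (dn k u) u := by
  have hcont : Continuous (am k) := by
    refine continuous_iff_continuousAt.2 fun x => ?_
    refine (LipschitzWith.of_dist_le_mul (K := 1) fun a b => ?_).continuous.continuousAt
    rw [NNReal.coe_one, one_mul, Real.dist_eq, Real.dist_eq]
    rcases le_total (am k a) (am k b) with h | h
    · have := le_ellipticF hk h
      rw [ellipticF_am hk, ellipticF_am hk] at this
      rw [abs_sub_comm, abs_of_nonneg (sub_nonneg.2 h), abs_sub_comm]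
      exact this.trans (le_abs_self _)
    · have := le_ellipticF hk h
      rw [ellipticF_am hk, ellipticF_am hk] at this
      rw [abs_of_nonneg (sub_nonneg.2 h)]
      exact this.trans (le_abs_self _)
  have h := HasDerivAt.of_local_left_inverse (f := ellipticF k) (g := am k) (a := u)
    hcont.continuousAt (hasDerivAt_ellipticF hk _)
    (one_div_pos.2 (Real.sqrt_pos.2 (radicand_pos hk _))).ne'
    (Filter.Eventually.of_forall (ellipticF_am hk))
  simpa [dn, sn] using h

theorem hasDerivAt_sn {k : ℝ} (hk : k ^ 2 < 1) (u : ℝ) :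
    HasDerivAt (sn k) (cn k u * dn k u) u :=
  (hasDerivAt_am hk u).sin

theorem hasDerivAt_cn {k : ℝ} (hk : k ^ 2 < 1) (u : ℝ) :
    HasDerivAt (cn k) (-sn k u * dn k u) u :=
  (hasDerivAt_am hk u).cos

theorem dn_sq {k : ℝ} (hk : k ^ 2 < 1) (u : ℝ) : dn k u ^ 2 = 1 - k ^ 2 * sn k u ^ 2 :=
  Real.sq_sqrt (radicand_pos hk _).le

theorem cn_sq (k u : ℝ) : cn k u ^ 2 = 1 - sn k u ^ 2 := by
  rw [cn, sn, Real.cos_sq']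

theorem hasDerivAt_dn {k : ℝ} (hk : k ^ 2 < 1) (u : ℝ) :
    HasDerivAt (dn k) (-k ^ 2 * sn k u * cn k u) u := by
  have h := ((((hasDerivAt_sn hk u).pow 2).const_mul (k ^ 2)).const_sub 1).sqrt
    (radicand_pos hk (am k u)).ne'
  have hd := (dn_pos hk u).ne'
  refine h.congr_deriv ?_
  change _ / (2 * dn k u) = _
  field_simp
  simp
  ring

theorem snC_ofReal {k : ℝ} (hk₀ : 0 < k) (hk₁ : k < 1) (x : ℝ) : snC k x = sn k x := by
  have hk' : √(1 - k ^ 2) ^ 2 < 1 := by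
    rw [Real.sq_sqrt (by nlinarith)]; nlinarith
  simp [snC, dn, sn, cn, am_zero hk']

theorem differentiableAt_snC {k : ℝ} (hk₀ : 0 < k) (hk₁ : k < 1) (z : ℂ)
    (hz : cn (√(1 - k ^ 2)) z.im ^ 2 + k ^ 2 * sn k z.re ^ 2 * sn (√(1 - k ^ 2)) z.im ^ 2 ≠ 0) :
    DifferentiableAt ℂ (snC k) z := by
  have hk : k ^ 2 < 1 := by nlinarith
  have hk'sq : √(1 - k ^ 2) ^ 2 = 1 - k ^ 2 := Real.sq_sqrt (by linarith)
  have hk' : √(1 - k ^ 2) ^ 2 < 1 := by rw [hk'sq]; nlinarith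
  set k' := √(1 - k ^ 2) with hk'def
  have hs := fun u => hasDerivAt_sn hk u
  have hc := fun u => hasDerivAt_cn hk u
  have hd := fun u => hasDerivAt_dn hk u
  have hs' := fun u => hasDerivAt_sn hk' u
  have hc' := fun u => hasDerivAt_cn hk' u
  have hd' := fun u => hasDerivAt_dn hk' u
  have e : snC k = fun w : ℂ => ((sn k w.re * dn k' w.im : ℝ) +
      I * (cn k w.re * dn k w.re * sn k' w.im * cn k' w.im : ℝ)) /
      ((cn k' w.im ^ 2 + k ^ 2 * sn k w.re ^ 2 * sn k' w.im ^ 2 : ℝ) : ℂ) := rfl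
  have hz' : ((cn k' z.im ^ 2 + k ^ 2 * sn k z.re ^ 2 * sn k' z.im ^ 2 : ℝ) : ℂ) ≠ 0 := by
    exact_mod_cast hz
  have hdiff : DifferentiableAt ℝ (snC k) z := by
    have h1 : DifferentiableAt ℝ (fun w : ℂ => sn k w.re) z :=
      (hs z.re).differentiableAt.comp z (by fun_prop)
    have h2 : DifferentiableAt ℝ (fun w : ℂ => cn k w.re) z :=
      (hc z.re).differentiableAt.comp z (by fun_prop)
    have h3 : DifferentiableAt ℝ (fun w : ℂ => dn k w.re) z :=
      (hd z.re).differentiableAt.comp z (by fun_prop)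
    have h4 : DifferentiableAt ℝ (fun w : ℂ => sn k' w.im) z :=
      (hs' z.im).differentiableAt.comp z (by fun_prop)
    have h5 : DifferentiableAt ℝ (fun w : ℂ => cn k' w.im) z :=
      (hc' z.im).differentiableAt.comp z (by fun_prop)
    have h6 : DifferentiableAt ℝ (fun w : ℂ => dn k' w.im) z :=
      (hd' z.im).differentiableAt.comp z (by fun_prop)
    have ho : ∀ {f : ℂ → ℝ}, DifferentiableAt ℝ f z → DifferentiableAt ℝ (fun w => (f w : ℂ)) z :=
      fun h => Complex.differentiable_ofReal.differentiableAt.comp z h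
    rw [e]
    have hn₁ := ho (h1.mul h6)
    have hn₂ := (differentiableAt_const (𝕜 := ℝ) (x := z) I).mul (ho (((h2.mul h3).mul h4).mul h5))
    have hq := ho (f := fun w => cn k' w.im ^ 2 + k ^ 2 * sn k w.re ^ 2 * sn k' w.im ^ 2)
      ((h5.pow 2).add (((h1.pow 2).const_mul (k ^ 2)).mul (h4.pow 2)))
    have hn := hn₁.add hn₂
    simp only [div_eq_mul_inv]
    exact hn.mul (hq.inv hz')
  refine differentiableAt_complex_iff_differentiableAt_real.2 ⟨hdiff, ?_⟩
  -- the two partial derivatives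
  have hx : HasDerivAt (fun t : ℝ => snC k (t + z.im * I)) (fderiv ℝ (snC k) z 1) z.re := by
    have hl : HasDerivAt (fun t : ℝ => (t : ℂ) + z.im * I) 1 z.re :=
      (Complex.ofRealCLM.hasDerivAt (x := z.re)).add_const _
    have hf : HasFDerivAt (snC k) (fderiv ℝ (snC k) z) ((z.re : ℂ) + z.im * I) := by
      rw [Complex.re_add_im]; exact hdiff.hasFDerivAt
    exact hf.comp_hasDerivAt z.re hl
  have hy : HasDerivAt (fun t : ℝ => snC k (z.re + t * I)) (fderiv ℝ (snC k) z I) z.im := by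
    have hl : HasDerivAt (fun t : ℝ => (z.re : ℂ) + t * I) I z.im := by
      simpa using ((Complex.ofRealCLM.hasDerivAt (x := z.im)).mul_const I).const_add (z.re : ℂ)
    have hf : HasFDerivAt (snC k) (fderiv ℝ (snC k) z) ((z.re : ℂ) + z.im * I) := by
      rw [Complex.re_add_im]; exact hdiff.hasFDerivAt
    exact hf.comp_hasDerivAt z.im hl
  have ex : (fun t : ℝ => snC k (t + z.im * I)) = fun t : ℝ => ((sn k t * dn k' z.im : ℝ) +
      I * (cn k t * dn k t * sn k' z.im * cn k' z.im : ℝ)) /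
      ((cn k' z.im ^ 2 + k ^ 2 * sn k t ^ 2 * sn k' z.im ^ 2 : ℝ) : ℂ) := by
    funext t; rw [e]; simp
  have ey : (fun t : ℝ => snC k (z.re + t * I)) = fun t : ℝ => ((sn k z.re * dn k' t : ℝ) +
      I * (cn k z.re * dn k z.re * sn k' t * cn k' t : ℝ)) /
      ((cn k' t ^ 2 + k ^ 2 * sn k z.re ^ 2 * sn k' t ^ 2 : ℝ) : ℂ) := by
    funext t; rw [e]; simp
  rw [ex] at hx
  rw [ey] at hy
  have hx2 := ((((hs z.re).mul_const (dn k' z.im)).ofReal_comp).add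
    ((((((hc z.re).mul (hd z.re)).mul_const (sn k' z.im)).mul_const
      (cn k' z.im)).ofReal_comp).const_mul I)).div
    (((((hs z.re).pow 2).const_mul (k ^ 2)).mul_const (sn k' z.im ^ 2)).const_add
      (cn k' z.im ^ 2)).ofReal_comp hz'
  have hy2 := ((((hd' z.im).const_mul (sn k z.re)).ofReal_comp).add
    (((((hs' z.im).const_mul (cn k z.re * dn k z.re)).mul (hc' z.im)).ofReal_comp).const_mul I)).div
    (((hc' z.im).pow 2).add (((hs' z.im).pow 2).const_mul (k ^ 2 * sn k z.re ^ 2))).ofReal_comp hz'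
  rw [hx.unique hx2, hy.unique hy2]
  have q1 := cn_sq k z.re
  have q2 := dn_sq hk z.re
  have q3 := cn_sq k' z.im
  have q4 := dn_sq hk' z.im
  rw [hk'sq] at q4
  simp only [Pi.add_apply, Pi.mul_apply, Pi.pow_apply, hk'sq]
  clear hx hy hx2 hy2 ex ey e hdiff hs hc hd hs' hc' hd' hz hz'
  generalize sn k z.re = s at *
  generalize cn k z.re = c at *
  generalize dn k z.re = d at *
  generalize sn k' z.im = s₁ at *
  generalize cn k' z.im = c₁ at *
  generalize dn k' z.im = d₁ at *
  rw [smul_eq_mul, ← mul_div_assoc]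
  congr 1
  apply Complex.ext
  · simp [-Complex.ofReal_add, -Complex.ofReal_mul, -Complex.ofReal_pow, -Complex.ofReal_neg]
    grind
  · simp [-Complex.ofReal_add, -Complex.ofReal_mul, -Complex.ofReal_pow, -Complex.ofReal_neg]
    grind

/-! ### The Ising parameters

`Kx`, `Ky` are the coupling constants, `N` is the number of sites in a column. -/

/-- The dual coupling `𝒦ₓ* = arctanh e^{-2𝒦ₓ}`. -/
def dual (Kx : ℝ) : ℝ := Real.artanh (Real.exp (-2 * Kx))

/-- `α = tanh 𝒦ₓ* coth 𝒦_y`. -/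
def alpha (Kx Ky : ℝ) : ℝ := Real.tanh (dual Kx) / Real.tanh Ky

/-- `β = tanh 𝒦ₓ* tanh 𝒦_y`. -/
def beta (Kx Ky : ℝ) : ℝ := Real.tanh (dual Kx) * Real.tanh Ky

/-- The lattice dispersion relation: the number `γ_θ ≥ 0` with
`cosh γ_θ = cosh 2𝒦ₓ* cosh 2𝒦_y - sinh 2𝒦ₓ* sinh 2𝒦_y cos θ`. -/
def gam (Kx Ky θ : ℝ) : ℝ :=
  Real.arcosh (Real.cosh (2 * dual Kx) * Real.cosh (2 * Ky) -
    Real.sinh (2 * dual Kx) * Real.sinh (2 * Ky) * Real.cos θ)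

/-- `b_θ = √((1 - α e^{iθ})(1 - β e^{-iθ}) / ((1 - β e^{iθ})(1 - α e^{-iθ})))`, where
`Complex.sqrt` is the principal branch of the square root (positive real part). -/
def b (Kx Ky θ : ℝ) : ℂ :=
  Complex.sqrt
    (((1 - alpha Kx Ky * Complex.exp (I * θ)) * (1 - beta Kx Ky * Complex.exp (-(I * θ)))) /
      ((1 - beta Kx Ky * Complex.exp (I * θ)) * (1 - alpha Kx Ky * Complex.exp (-(I * θ)))))

/-- The modulus `k = sinh 2𝒦ₓ* / sinh 2𝒦_y`. -/
def modulus (Kx Ky : ℝ) : ℝ := Real.sinh (2 * dual Kx) / Real.sinh (2 * Ky)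

/-! ### The elliptic parametrization of the spectral curve -/

/-- `η ∈ (-K'/2, 0)` and `sinh 2𝒦ₓ = i sn(2iη)`. -/
def IsEta (Kx Ky η : ℝ) : Prop :=
  η ∈ Set.Ioo (-(ellipticK (√(1 - modulus Kx Ky ^ 2)) / 2)) 0 ∧
    (Real.sinh (2 * Kx) : ℂ) = I * snC (modulus Kx Ky) (2 * I * η)

/-- The real parameter `η` determined by `IsEta`. -/
def eta (Kx Ky : ℝ) : ℝ := Classical.epsilon (IsEta Kx Ky)

/-- `z(u) = sn(u + iη) / sn(u - iη)`. -/
def zMap (Kx Ky : ℝ) (u : ℂ) : ℂ :=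
  snC (modulus Kx Ky) (u + I * eta Kx Ky) / snC (modulus Kx Ky) (u - I * eta Kx Ky)

/-- `λ(u) = 1 / (k sn(u + iη) sn(u - iη))`. -/
def lamMap (Kx Ky : ℝ) (u : ℂ) : ℂ :=
  (modulus Kx Ky * snC (modulus Kx Ky) (u + I * eta Kx Ky) *
    snC (modulus Kx Ky) (u - I * eta Kx Ky))⁻¹

/-- `u ∈ [-K, K)` is the elliptic parameter of the point `(e^{iθ}, e^{γ_θ})` of the spectral
curve. -/
def IsU (Kx Ky θ u : ℝ) : Prop :=
  u ∈ Set.Ico (-ellipticK (modulus Kx Ky)) (ellipticK (modulus Kx Ky)) ∧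
    zMap Kx Ky u = Complex.exp (I * θ) ∧ lamMap Kx Ky u = Real.exp (gam Kx Ky θ)

/-- The elliptic parameter `u_θ` determined by `IsU`. -/
def uu (Kx Ky θ : ℝ) : ℝ := Classical.epsilon (IsU Kx Ky θ)

/-! ### The matrices

Rows of `D`, `C`, `B`, `Φ`, `Ψ` are indexed by the periodic quasimomenta and columns by the
antiperiodic ones. -/

/-- The periodic quasimomenta `0, 2π/N, …, 2π - 2π/N`. -/
def thetaP (N : ℕ) (j : Fin N) : ℝ := 2 * π * (j : ℕ) / N

/-- The antiperiodic quasimomenta `π/N, 3π/N, …, 2π - π/N`. -/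
def thetaA (N : ℕ) (j : Fin N) : ℝ := (2 * (j : ℕ) + 1) * π / N

/-- `D_{θ,θ'} = e^{-i(l-1/2)(θ-θ')} / (2iN sin((θ'-θ)/2)) (√(b_θ'/b_θ) + √(b_θ/b_θ'))`. -/
def matD (Kx Ky : ℝ) (N : ℕ) (l : ℤ) : Matrix (Fin N) (Fin N) ℂ := Matrix.of fun i j =>
  let θ := thetaP N i
  let θ' := thetaA N j
  Complex.exp (-(I * ((l - 1 / 2) * (θ - θ')))) / (2 * I * N * Real.sin ((θ' - θ) / 2)) *
    (Complex.sqrt (b Kx Ky θ' / b Kx Ky θ) + Complex.sqrt (b Kx Ky θ / b Kx Ky θ'))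

/-- `C_{θ,θ'} = e^{-i(l-1/2)(θ+θ')} / (2iN sin((θ+θ')/2)) (√(b_θ b_θ') - 1/√(b_θ b_θ'))`. -/
def matC (Kx Ky : ℝ) (N : ℕ) (l : ℤ) : Matrix (Fin N) (Fin N) ℂ := Matrix.of fun i j =>
  let θ := thetaP N i
  let θ' := thetaA N j
  Complex.exp (-(I * ((l - 1 / 2) * (θ + θ')))) / (2 * I * N * Real.sin ((θ + θ') / 2)) *
    (Complex.sqrt (b Kx Ky θ * b Kx Ky θ') - 1 / Complex.sqrt (b Kx Ky θ * b Kx Ky θ'))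

/-- Entrywise complex conjugation. -/
def conjMat {m n : Type*} (M : Matrix m n ℂ) : Matrix m n ℂ := M.map (starRingEnd ℂ)

/-- `B` is the entrywise complex conjugate of `C`. -/
def matB (Kx Ky : ℝ) (N : ℕ) (l : ℤ) : Matrix (Fin N) (Fin N) ℂ := conjMat (matC Kx Ky N l)

/-- The diagonal matrix with entries `e^{i(l-1/2)θ} / √(sinh γ_θ)`, `θ` running through a given
family of quasimomenta. -/
def matLam (Kx Ky : ℝ) (l : ℤ) {N : ℕ} (θ : Fin N → ℝ) : Matrix (Fin N) (Fin N) ℂ :=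
  Matrix.diagonal fun j =>
    Complex.exp (I * ((l - 1 / 2) * θ j)) / (√(Real.sinh (gam Kx Ky (θ j))) : ℝ)

/-- `Λ_p`. -/
def lamP (Kx Ky : ℝ) (N : ℕ) (l : ℤ) : Matrix (Fin N) (Fin N) ℂ := matLam Kx Ky l (thetaP N)

/-- `Λ_a`. -/
def lamA (Kx Ky : ℝ) (N : ℕ) (l : ℤ) : Matrix (Fin N) (Fin N) ℂ := matLam Kx Ky l (thetaA N)

/-- `Φ_{θ,θ'} = dn(u_θ - u_θ') / sn(u_θ - u_θ')`. -/
def matPhi (Kx Ky : ℝ) (N : ℕ) : Matrix (Fin N) (Fin N) ℂ := Matrix.of fun i j =>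
  let x := uu Kx Ky (thetaP N i) - uu Kx Ky (thetaA N j)
  ((dn (modulus Kx Ky) x / sn (modulus Kx Ky) x : ℝ) : ℂ)

/-- `Ψ_{θ,θ'} = cn(u_θ - u_θ')`. -/
def matPsi (Kx Ky : ℝ) (N : ℕ) : Matrix (Fin N) (Fin N) ℂ := Matrix.of fun i j =>
  ((cn (modulus Kx Ky) (uu Kx Ky (thetaP N i) - uu Kx Ky (thetaA N j)) : ℝ) : ℂ)

end Ising

end

open Ising

noncomputable section

namespace Ising

open Real Complex Matrix

/-! Everything reduces to the Jacobi addition theorems, by writing both angles and symbols through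
the same elliptic data. Put `s, c, d` for the Jacobi functions at real `u` with modulus `k`, and
`s₁, c₁, d₁` (`s₂, c₂, d₂`) for those at `η` (at `2η`) with the complementary modulus. The equation
for `η` expresses the hyperbolic functions of both couplings, hence `α` and `β`, rationally in `s₂,
c₂, d₂` and `k`.

On the real axis `sn(u + iη)` and `sn(u - iη)` are complex conjugate. Up to a positive factor they
are `-(X ± iY)`, where `X = -s d₁` and `Y = -c d s₁ c₁`. So `z(u) = e^{iθ}` says that `X + iY` has
direction `e^{iθ/2}` up to sign, and as `u` runs over `[-K, K)` this vector turns through the upper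
half-plane from angle `0` towards `π`. The intermediate value theorem gives existence of `u_θ`.
Uniqueness holds because the cross product of two such vectors is a constant times the numerator of
`sn(u - v)`. The equation for `λ` is then automatic, by the dispersion relation and `λ > 1`.

The symbol `(1 - α e^{iθ})(1 - β e^{-iθ})` is a positive multiple of `(d + i k s c)²`. Hence `√b` is
the unit vector `p + iq` along `d + i k s c`. The inequality `|k s c| < d` (`abs_rootIm_lt`) settles
every choice of branch. In the kernels, `√(b/b') + √(b'/b)` produces the numerator of `dn(u - v)`
and `sin((θ - θ')/2)` that of `sn(u - v)`. The other kernel uses `cn_sub_mul`. The remaining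
constants agree by the duplication formula for `s₂`.

Invertibility of `D` needs no determinant evaluation. Up to invertible diagonal factors, `D` is
`diag(b) W + W diag(b')`, where `W` is a multiple of a unitary Fourier-type matrix and `Re b > 0`.
For a kernel vector `v`, pairing with `W v` and taking real parts forces `v = 0`. The kernels factor
`D`, `B`, `C` through `Φ`, `Ψ` and the diagonal `Λ`, so `Φ` is invertible as well, and the remaining
formulas are matrix algebra. -/

/-! ### Real Jacobi functions: symmetries, quarter period, signs -/

theorem ellipticF_neg (k φ : ℝ) : ellipticF k (-φ) = -ellipticF k φ := by
  have h := intervalIntegral.integral_comp_neg (a := 0) (b := φ)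
    (fun t : ℝ => 1 / √(1 - k ^ 2 * Real.sin t ^ 2))
  simp only [Real.sin_neg, neg_sq, neg_zero] at h
  rw [ellipticF, ellipticF, h, intervalIntegral.integral_symm]

theorem ellipticF_zero (k : ℝ) : ellipticF k 0 = 0 := by simp [ellipticF]

theorem am_ellipticF {k : ℝ} (hk : k ^ 2 < 1) (φ : ℝ) : am k (ellipticF k φ) = φ :=
  (strictMono_ellipticF hk).injective (ellipticF_am hk _)

theorem am_neg {k : ℝ} (hk : k ^ 2 < 1) (u : ℝ) : am k (-u) = -am k u :=
  (strictMono_ellipticF hk).injective (by rw [ellipticF_neg, ellipticF_am hk, ellipticF_am hk])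

theorem sn_neg {k : ℝ} (hk : k ^ 2 < 1) (u : ℝ) : sn k (-u) = -sn k u := by
  rw [sn, sn, am_neg hk, Real.sin_neg]

theorem cn_neg {k : ℝ} (hk : k ^ 2 < 1) (u : ℝ) : cn k (-u) = cn k u := by
  rw [cn, cn, am_neg hk, Real.cos_neg]

theorem dn_neg {k : ℝ} (hk : k ^ 2 < 1) (u : ℝ) : dn k (-u) = dn k u := by
  rw [dn, dn, sn_neg hk, neg_sq]

theorem sn_zero {k : ℝ} (hk : k ^ 2 < 1) : sn k 0 = 0 := by simp [sn, am_zero hk]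

theorem cn_zero {k : ℝ} (hk : k ^ 2 < 1) : cn k 0 = 1 := by simp [cn, am_zero hk]

theorem dn_zero {k : ℝ} (hk : k ^ 2 < 1) : dn k 0 = 1 := by simp [dn, sn_zero hk]

theorem strictMono_am {k : ℝ} (hk : k ^ 2 < 1) : StrictMono (am k) :=
  strictMono_of_deriv_pos fun u => by rw [(hasDerivAt_am hk u).deriv]; exact dn_pos hk u

theorem continuous_ellipticF {k : ℝ} (hk : k ^ 2 < 1) : Continuous (ellipticF k) :=
  continuous_iff_continuousAt.2 fun u => (hasDerivAt_ellipticF hk u).continuousAt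

/-- The complete integral in amplitude form. -/
theorem ellipticK_eq {k : ℝ} (hk : k ^ 2 < 1) : ellipticK k = ellipticF k (π / 2) := by
  have hcont : ContinuousOn (fun t => ellipticF k (Real.arcsin t)) (Set.uIcc 0 1) :=
    ((continuous_ellipticF hk).comp Real.continuous_arcsin).continuousOn
  have hderiv : ∀ t ∈ Set.Ioo (0 : ℝ) 1, HasDerivAt (fun t => ellipticF k (Real.arcsin t))
      (1 / √((1 - t ^ 2) * (1 - k ^ 2 * t ^ 2))) t := by
    intro t ht
    have h := (hasDerivAt_ellipticF hk (Real.arcsin t)).comp t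
      (Real.hasDerivAt_arcsin (by linarith [ht.1]) (by linarith [ht.2]))
    rw [Real.sin_arcsin (by linarith [ht.1]) ht.2.le] at h
    refine h.congr_deriv ?_
    rw [Real.sqrt_mul (by nlinarith [ht.1, ht.2]), div_mul_div_comm, one_mul, mul_comm]
  -- The integrand is singular at `t = 1`. It is integrable because it is a nonnegative derivative
  -- of a function continuous up to the endpoint.
  have hint : IntervalIntegrable (fun t : ℝ => 1 / √((1 - t ^ 2) * (1 - k ^ 2 * t ^ 2)))
      MeasureTheory.volume 0 1 := by
    refine intervalIntegral.intervalIntegrable_deriv_of_nonneg hcont ?_ ?_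
    · simpa using hderiv
    · intro t _; positivity
  have h := intervalIntegral.integral_eq_sub_of_hasDerivAt_of_le zero_le_one
    (by simpa using hcont) hderiv hint
  rw [ellipticK, h, Real.arcsin_one, Real.arcsin_zero, ellipticF_zero, sub_zero]

/-- The integrand is symmetric under `t ↦ π - t`. -/
theorem ellipticF_pi {k : ℝ} (hk : k ^ 2 < 1) : ellipticF k π = 2 * ellipticK k := by
  have hi := fun a b => (continuous_integrand hk).intervalIntegrable (μ := MeasureTheory.volume) a b
  have h := intervalIntegral.integral_comp_sub_left (a := 0) (b := π / 2)
    (fun t : ℝ => 1 / √(1 - k ^ 2 * Real.sin t ^ 2)) π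
  simp only [Real.sin_pi_sub, sub_zero] at h
  rw [ellipticK_eq hk, two_mul]
  nth_rewrite 2 [ellipticF]
  rw [h, show π - π / 2 = π / 2 by ring, ellipticF, ellipticF, add_comm,
    intervalIntegral.integral_add_adjacent_intervals (hi _ _) (hi _ _)]

theorem ellipticK_pos {k : ℝ} (hk : k ^ 2 < 1) : 0 < ellipticK k := by
  rw [ellipticK_eq hk, ← ellipticF_zero k]
  exact strictMono_ellipticF hk (by positivity)

theorem am_ellipticK {k : ℝ} (hk : k ^ 2 < 1) : am k (ellipticK k) = π / 2 := by
  rw [ellipticK_eq hk, am_ellipticF hk]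

theorem sn_ellipticK {k : ℝ} (hk : k ^ 2 < 1) : sn k (ellipticK k) = 1 := by
  rw [sn, am_ellipticK hk, Real.sin_pi_div_two]

theorem cn_ellipticK {k : ℝ} (hk : k ^ 2 < 1) : cn k (ellipticK k) = 0 := by
  rw [cn, am_ellipticK hk, Real.cos_pi_div_two]

theorem am_mem_Ioo {k : ℝ} (hk : k ^ 2 < 1) {u : ℝ}
    (hu : u ∈ Set.Ioo (-ellipticK k) (ellipticK k)) : am k u ∈ Set.Ioo (-(π / 2)) (π / 2) := by
  have h1 := strictMono_am hk hu.1
  have h2 := strictMono_am hk hu.2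
  rw [am_neg hk, am_ellipticK hk] at h1
  rw [am_ellipticK hk] at h2
  exact ⟨h1, h2⟩

theorem cn_pos {k : ℝ} (hk : k ^ 2 < 1) {u : ℝ}
    (hu : u ∈ Set.Ioo (-ellipticK k) (ellipticK k)) : 0 < cn k u :=
  Real.cos_pos_of_mem_Ioo (am_mem_Ioo hk hu)

theorem sn_neg_of_mem {k : ℝ} (hk : k ^ 2 < 1) {u : ℝ}
    (hu : u ∈ Set.Ioo (-(2 * ellipticK k)) 0) : sn k u < 0 := by
  have h1 := strictMono_am hk hu.1
  have h2 := strictMono_am hk hu.2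
  rw [am_neg hk, ← ellipticF_pi hk, am_ellipticF hk] at h1
  rw [am_zero hk] at h2
  exact Real.sin_neg_of_neg_of_neg_pi_lt h2 h1

theorem eq_zero_of_sn_eq_zero {k : ℝ} (hk : k ^ 2 < 1) {u : ℝ} (h₁ : -(2 * ellipticK k) < u)
    (h₂ : u < 2 * ellipticK k) (h : sn k u = 0) : u = 0 := by
  rcases lt_trichotomy u 0 with h0 | h0 | h0
  · exact absurd h (sn_neg_of_mem hk ⟨h₁, h0⟩).ne
  · exact h0
  · have := sn_neg_of_mem hk (u := -u) ⟨by linarith, by linarith⟩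
    rw [sn_neg hk, h] at this
    simp at this

theorem sn_sq_le_one (k u : ℝ) : sn k u ^ 2 ≤ 1 := Real.sin_sq_le_one _

/-! ### Addition and duplication theorems -/

theorem addition_denom_pos {k : ℝ} (hk : k ^ 2 < 1) (u v : ℝ) :
    0 < 1 - k ^ 2 * sn k u ^ 2 * sn k v ^ 2 := by
  have h1 := sn_sq_le_one k u
  have h2 := sn_sq_le_one k v
  have h3 : sn k u ^ 2 * sn k v ^ 2 ≤ 1 := mul_le_one₀ h1 (sq_nonneg _) h2
  nlinarith [mul_nonneg (sq_nonneg k) (sub_nonneg.2 h3)]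

theorem eq_of_hasDerivAt_zero {f : ℝ → ℝ} (h : ∀ x, HasDerivAt f 0 x) (x y : ℝ) : f x = f y :=
  is_const_of_deriv_eq_zero (fun x => (h x).differentiableAt) (fun x => (h x).deriv) x y

/-- With the difference of the arguments held fixed, the right-hand side at `(u - v + x, x)` has
zero derivative in `x`. Its value at `x = 0` is `sn(u - v)`, and at `x = v` it is the claimed
expression. The theorems for `cn` and `dn` follow in the same way. -/
theorem sn_sub {k : ℝ} (hk : k ^ 2 < 1) (u v : ℝ) :
    sn k (u - v) = (sn k u * cn k v * dn k v - sn k v * cn k u * dn k u) /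
      (1 - k ^ 2 * sn k u ^ 2 * sn k v ^ 2) := by
  have key := eq_of_hasDerivAt_zero (f := fun x =>
    (sn k (u - v + x) * cn k x * dn k x - sn k x * cn k (u - v + x) * dn k (u - v + x)) /
      (1 - k ^ 2 * sn k (u - v + x) ^ 2 * sn k x ^ 2)) ?_ v 0
  · simp only [sub_add_cancel, add_zero, sn_zero hk, cn_zero hk, dn_zero hk] at key
    rw [key]; simp
  · intro x
    have S := (hasDerivAt_sn hk (u - v + x)).comp_const_add (u - v) x
    have C := (hasDerivAt_cn hk (u - v + x)).comp_const_add (u - v) x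
    have D := (hasDerivAt_dn hk (u - v + x)).comp_const_add (u - v) x
    have S' := hasDerivAt_sn hk x
    have C' := hasDerivAt_cn hk x
    have D' := hasDerivAt_dn hk x
    refine ((((S.mul C').mul D').sub ((S'.mul C).mul D)).div
      ((((S.pow 2).const_mul (k ^ 2)).mul (S'.pow 2)).const_sub 1)
      (addition_denom_pos hk _ _).ne').congr_deriv ?_
    have q1 := cn_sq k x
    have q2 := dn_sq hk x
    have q3 := cn_sq k (u - v + x)
    have q4 := dn_sq hk (u - v + x)
    simp only [Pi.mul_apply, Pi.pow_apply, Pi.sub_apply]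
    rw [div_eq_zero_iff]
    left
    clear S C D S' C' D'
    generalize sn k x = s at *
    generalize cn k x = c at *
    generalize dn k x = d at *
    generalize sn k (u - v + x) = s₁ at *
    generalize cn k (u - v + x) = c₁ at *
    generalize dn k (u - v + x) = d₁ at *
    grind

theorem cn_sub {k : ℝ} (hk : k ^ 2 < 1) (u v : ℝ) :
    cn k (u - v) = (cn k u * cn k v + sn k u * sn k v * dn k u * dn k v) /
      (1 - k ^ 2 * sn k u ^ 2 * sn k v ^ 2) := by
  have key := eq_of_hasDerivAt_zero (f := fun x =>
    (cn k (u - v + x) * cn k x + sn k (u - v + x) * sn k x * dn k (u - v + x) * dn k x) /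
      (1 - k ^ 2 * sn k (u - v + x) ^ 2 * sn k x ^ 2)) ?_ v 0
  · simp only [sub_add_cancel, add_zero, sn_zero hk, cn_zero hk, dn_zero hk] at key
    rw [key]; simp
  · intro x
    have S := (hasDerivAt_sn hk (u - v + x)).comp_const_add (u - v) x
    have C := (hasDerivAt_cn hk (u - v + x)).comp_const_add (u - v) x
    have D := (hasDerivAt_dn hk (u - v + x)).comp_const_add (u - v) x
    have S' := hasDerivAt_sn hk x
    have C' := hasDerivAt_cn hk x
    have D' := hasDerivAt_dn hk x
    refine (((C.mul C').add (((S.mul S').mul D).mul D')).div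
      ((((S.pow 2).const_mul (k ^ 2)).mul (S'.pow 2)).const_sub 1)
      (addition_denom_pos hk _ _).ne').congr_deriv ?_
    have q1 := cn_sq k x
    have q2 := dn_sq hk x
    have q3 := cn_sq k (u - v + x)
    have q4 := dn_sq hk (u - v + x)
    simp only [Pi.mul_apply, Pi.pow_apply, Pi.add_apply]
    rw [div_eq_zero_iff]
    left
    clear S C D S' C' D'
    generalize sn k x = s at *
    generalize cn k x = c at *
    generalize dn k x = d at *
    generalize sn k (u - v + x) = s₁ at *
    generalize cn k (u - v + x) = c₁ at *
    generalize dn k (u - v + x) = d₁ at *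
    grind

theorem dn_sub {k : ℝ} (hk : k ^ 2 < 1) (u v : ℝ) :
    dn k (u - v) = (dn k u * dn k v + k ^ 2 * sn k u * sn k v * cn k u * cn k v) /
      (1 - k ^ 2 * sn k u ^ 2 * sn k v ^ 2) := by
  have key := eq_of_hasDerivAt_zero (f := fun x =>
    (dn k (u - v + x) * dn k x + k ^ 2 * sn k (u - v + x) * sn k x * cn k (u - v + x) * cn k x) /
      (1 - k ^ 2 * sn k (u - v + x) ^ 2 * sn k x ^ 2)) ?_ v 0
  · simp only [sub_add_cancel, add_zero, sn_zero hk, cn_zero hk, dn_zero hk] at key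
    rw [key]; simp
  · intro x
    have S := (hasDerivAt_sn hk (u - v + x)).comp_const_add (u - v) x
    have C := (hasDerivAt_cn hk (u - v + x)).comp_const_add (u - v) x
    have D := (hasDerivAt_dn hk (u - v + x)).comp_const_add (u - v) x
    have S' := hasDerivAt_sn hk x
    have C' := hasDerivAt_cn hk x
    have D' := hasDerivAt_dn hk x
    refine (((D.mul D').add ((((S.const_mul (k ^ 2)).mul S').mul C).mul C')).div
      ((((S.pow 2).const_mul (k ^ 2)).mul (S'.pow 2)).const_sub 1)
      (addition_denom_pos hk _ _).ne').congr_deriv ?_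
    have q1 := cn_sq k x
    have q2 := dn_sq hk x
    have q3 := cn_sq k (u - v + x)
    have q4 := dn_sq hk (u - v + x)
    simp only [Pi.mul_apply, Pi.pow_apply, Pi.add_apply]
    rw [div_eq_zero_iff]
    left
    clear S C D S' C' D'
    generalize sn k x = s at *
    generalize cn k x = c at *
    generalize dn k x = d at *
    generalize sn k (u - v + x) = s₁ at *
    generalize cn k (u - v + x) = c₁ at *
    generalize dn k (u - v + x) = d₁ at *
    grind

theorem sn_two_mul {k : ℝ} (hk : k ^ 2 < 1) (u : ℝ) :
    sn k (2 * u) * (1 - k ^ 2 * sn k u ^ 4) = 2 * sn k u * cn k u * dn k u := by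
  have h := sn_sub hk u (-u)
  have hp := addition_denom_pos hk u u
  rw [sn_neg hk, cn_neg hk, dn_neg hk, neg_sq, eq_div_iff hp.ne'] at h
  rw [two_mul, ← sub_neg_eq_add]
  linear_combination h

theorem cn_two_mul {k : ℝ} (hk : k ^ 2 < 1) (u : ℝ) :
    cn k (2 * u) * (1 - k ^ 2 * sn k u ^ 4) = cn k u ^ 2 - sn k u ^ 2 * dn k u ^ 2 := by
  have h := cn_sub hk u (-u)
  have hp := addition_denom_pos hk u u
  rw [sn_neg hk, cn_neg hk, dn_neg hk, neg_sq, eq_div_iff hp.ne'] at h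
  rw [two_mul, ← sub_neg_eq_add]
  linear_combination h

theorem dn_two_mul {k : ℝ} (hk : k ^ 2 < 1) (u : ℝ) :
    dn k (2 * u) * (1 - k ^ 2 * sn k u ^ 4) =
      dn k u ^ 2 - k ^ 2 * sn k u ^ 2 * cn k u ^ 2 := by
  have h := dn_sub hk u (-u)
  have hp := addition_denom_pos hk u u
  rw [sn_neg hk, cn_neg hk, dn_neg hk, neg_sq, eq_div_iff hp.ne'] at h
  rw [two_mul, ← sub_neg_eq_add]
  linear_combination h

/-! ### Dual coupling and modulus -/

theorem exp_neg_two_mul_mem {Kx : ℝ} (hKx : 0 < Kx) :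
    Real.exp (-2 * Kx) ∈ Set.Ioo (0 : ℝ) 1 :=
  ⟨Real.exp_pos _, Real.exp_lt_one_iff.2 (by linarith)⟩

theorem dual_pos {Kx : ℝ} (hKx : 0 < Kx) : 0 < dual Kx :=
  Real.artanh_pos (exp_neg_two_mul_mem hKx)

theorem sinh_two_mul_dual {Kx : ℝ} (hKx : 0 < Kx) :
    Real.sinh (2 * dual Kx) * Real.sinh (2 * Kx) = 1 := by
  have hx := exp_neg_two_mul_mem hKx
  have he : Real.exp (2 * Kx) = (Real.exp (-2 * Kx))⁻¹ := by rw [← Real.exp_neg]; ring_nf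
  have hx' : Real.exp (-2 * Kx) ∈ Set.Ioo (-1 : ℝ) 1 := ⟨by linarith [hx.1], hx.2⟩
  rw [Real.sinh_two_mul, dual, Real.sinh_artanh hx', Real.cosh_artanh hx', Real.sinh_eq, he,
    show -(2 * Kx) = -2 * Kx by ring]
  generalize Real.exp (-2 * Kx) = x at *
  have h1 : 0 < 1 - x ^ 2 := by nlinarith [hx.1, hx.2]
  have h2 := hx.1.ne'
  have h3 := Real.sq_sqrt h1.le
  have h4 := (Real.sqrt_pos.2 h1).ne'
  field_simp
  rw [h3]

theorem tanh_eq_sinh_two_mul_div (x : ℝ) :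
    Real.tanh x = Real.sinh (2 * x) / (1 + Real.cosh (2 * x)) := by
  have h := Real.cosh_pos x
  rw [Real.tanh_eq_sinh_div_cosh, Real.sinh_two_mul, Real.cosh_two_mul, Real.sinh_sq,
    show 1 + (Real.cosh x ^ 2 + (Real.cosh x ^ 2 - 1)) = 2 * Real.cosh x ^ 2 by ring]
  field_simp

section Couplings

variable {Kx Ky : ℝ} (hKx : 0 < Kx) (hKy : dual Kx < Ky)
include hKx hKy

theorem modulus_pos : 0 < modulus Kx Ky := by
  have h := dual_pos hKx
  exact div_pos (Real.sinh_pos_iff.2 (by linarith)) (Real.sinh_pos_iff.2 (by linarith))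

theorem modulus_lt_one : modulus Kx Ky < 1 := by
  have h := dual_pos hKx
  rw [modulus, div_lt_one (Real.sinh_pos_iff.2 (by linarith))]
  exact Real.sinh_lt_sinh.2 (by linarith)

theorem modulus_sq_lt_one : modulus Kx Ky ^ 2 < 1 := by
  nlinarith [modulus_pos hKx hKy, modulus_lt_one hKx hKy]

theorem compl_modulus_sq : √(1 - modulus Kx Ky ^ 2) ^ 2 = 1 - modulus Kx Ky ^ 2 :=
  Real.sq_sqrt (by linarith [modulus_sq_lt_one hKx hKy])

theorem compl_modulus_sq_lt_one : √(1 - modulus Kx Ky ^ 2) ^ 2 < 1 := by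
  rw [compl_modulus_sq hKx hKy]
  have := modulus_pos hKx hKy
  nlinarith

end Couplings

/-! ### The parameter `η` and the couplings as elliptic values -/

theorem snC_imaginary {k : ℝ} (hk : k ^ 2 < 1) (y : ℝ)
    (hy : cn (√(1 - k ^ 2)) y ≠ 0) :
    snC k (I * y) = I * (sn (√(1 - k ^ 2)) y / cn (√(1 - k ^ 2)) y : ℝ) := by
  have hy' : ((cn (√(1 - k ^ 2)) y : ℝ) : ℂ) ≠ 0 := by exact_mod_cast hy
  simp [snC, sn_zero hk, cn_zero hk, dn_zero hk]
  field_simp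

section Eta

variable {Kx Ky : ℝ} (hKx : 0 < Kx) (hKy : dual Kx < Ky)
include hKx hKy

/-- On the imaginary axis `sn(iy, k) = i tan(am(y, k'))`, so the complex condition becomes real.
Since `2η` lies in `(-K', 0)`, the tangent has no pole. -/
theorem isEta_iff {η : ℝ} (hη : η ∈ Set.Ioo (-(ellipticK (√(1 - modulus Kx Ky ^ 2)) / 2)) 0) :
    IsEta Kx Ky η ↔
      Real.sinh (2 * Kx) = -Real.tan (am (√(1 - modulus Kx Ky ^ 2)) (2 * η)) := by
  have hk := compl_modulus_sq_lt_one hKx hKy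
  have hc := cn_pos hk (u := 2 * η) ⟨by linarith [hη.1], by linarith [hη.2, ellipticK_pos hk]⟩
  rw [IsEta, and_iff_right hη, show (2 * I * η : ℂ) = I * ((2 * η : ℝ) : ℂ) by push_cast; ring,
    snC_imaginary (modulus_sq_lt_one hKx hKy) _ hc.ne', ← mul_assoc, I_mul_I, Real.tan_eq_sin_div_cos]
  rw [neg_one_mul, ← Complex.ofReal_neg, Complex.ofReal_inj]
  rfl

theorem existsUnique_isEta : ∃! η : ℝ, IsEta Kx Ky η := by
  have hk := compl_modulus_sq_lt_one hKx hKy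
  have hA : 0 < Real.sinh (2 * Kx) := Real.sinh_pos_iff.2 (by linarith)
  have hat := Real.arctan_pos.2 hA
  have hlo := strictMono_ellipticF hk (neg_lt_neg (Real.arctan_lt_pi_div_two (Real.sinh (2 * Kx))))
  have hhi := strictMono_ellipticF hk (neg_lt_zero.2 hat)
  rw [ellipticF_neg, ← ellipticK_eq hk] at hlo
  rw [ellipticF_zero] at hhi
  -- The amplitude of `2η` must be `-arctan(sinh 2𝒦ₓ)`, and `ellipticF` inverts the amplitude.
  refine ⟨ellipticF (√(1 - modulus Kx Ky ^ 2)) (-Real.arctan (Real.sinh (2 * Kx))) / 2, ?_, ?_⟩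
  · refine (isEta_iff hKx hKy ⟨by linarith, by linarith⟩).2 ?_
    rw [mul_div_cancel₀ _ two_ne_zero, am_ellipticF hk, Real.tan_neg, Real.tan_arctan, neg_neg]
  · intro η h
    have hη := h.1
    have h1 := (isEta_iff hKx hKy hη).1 h
    have h2 := am_mem_Ioo hk (u := 2 * η)
      ⟨by linarith [hη.1], by linarith [hη.2, ellipticK_pos hk]⟩
    rw [h1, ← Real.tan_neg, Real.arctan_tan (by linarith [h2.2]) (by linarith [h2.1]), neg_neg,
      ellipticF_am hk, mul_div_cancel_left₀ _ two_ne_zero]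

theorem isEta_eta : IsEta Kx Ky (eta Kx Ky) :=
  Classical.epsilon_spec (existsUnique_isEta hKx hKy).exists

end Eta

/-- The values `s₁, c₁, d₁` and `s₂, c₂, d₂` of the Jacobi functions of the complementary modulus
at `η` and `2η`, with the relations and signs that they satisfy. -/
structure EtaValues (Kx Ky k s₁ c₁ d₁ s₂ c₂ d₂ : ℝ) : Prop where
  k_pos : 0 < k
  k_lt_one : k < 1
  s₁_neg : s₁ < 0
  c₁_pos : 0 < c₁
  d₁_pos : 0 < d₁
  s₂_neg : s₂ < 0
  c₂_pos : 0 < c₂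
  d₂_pos : 0 < d₂
  c₁_sq : c₁ ^ 2 = 1 - s₁ ^ 2
  d₁_sq : d₁ ^ 2 = 1 - (1 - k ^ 2) * s₁ ^ 2
  c₂_sq : c₂ ^ 2 = 1 - s₂ ^ 2
  d₂_sq : d₂ ^ 2 = 1 - (1 - k ^ 2) * s₂ ^ 2
  denom_pos : 0 < 1 - (1 - k ^ 2) * s₁ ^ 4
  s₂_mul : s₂ * (1 - (1 - k ^ 2) * s₁ ^ 4) = 2 * s₁ * c₁ * d₁
  c₂_mul : c₂ * (1 - (1 - k ^ 2) * s₁ ^ 4) = c₁ ^ 2 - s₁ ^ 2 * d₁ ^ 2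
  d₂_mul : d₂ * (1 - (1 - k ^ 2) * s₁ ^ 4) = d₁ ^ 2 - (1 - k ^ 2) * s₁ ^ 2 * c₁ ^ 2
  sinh_dual : Real.sinh (2 * dual Kx) = -c₂ / s₂
  cosh_dual : Real.cosh (2 * dual Kx) = -1 / s₂
  sinh_Ky : Real.sinh (2 * Ky) = -c₂ / (k * s₂)
  cosh_Ky : Real.cosh (2 * Ky) = -d₂ / (k * s₂)

/-- Both `η` and `2η` lie in `(-K', 0)`, which fixes the signs. The condition on `η` says `sinh 2𝒦ₓ
= -s₂/c₂`. Duality takes the reciprocal, division by `k` gives `sinh 2𝒦_y`, and the values of `cosh`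
are the positive square roots of `1 + sinh²`. -/
theorem etaValues {Kx Ky : ℝ} (hKx : 0 < Kx) (hKy : dual Kx < Ky) :
    EtaValues Kx Ky (modulus Kx Ky)
      (sn (√(1 - modulus Kx Ky ^ 2)) (eta Kx Ky)) (cn (√(1 - modulus Kx Ky ^ 2)) (eta Kx Ky))
      (dn (√(1 - modulus Kx Ky ^ 2)) (eta Kx Ky)) (sn (√(1 - modulus Kx Ky ^ 2)) (2 * eta Kx Ky))
      (cn (√(1 - modulus Kx Ky ^ 2)) (2 * eta Kx Ky))
      (dn (√(1 - modulus Kx Ky ^ 2)) (2 * eta Kx Ky)) := by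
  have hk := compl_modulus_sq_lt_one hKx hKy
  have hK := ellipticK_pos hk
  have h := isEta_eta hKx hKy
  have hη := h.1
  have hA := (isEta_iff hKx hKy hη).1 h
  rw [Real.tan_eq_sin_div_cos] at hA
  change _ = -(sn _ _ / cn _ _) at hA
  have hk0 := modulus_pos hKx hKy
  have hs1 := sn_neg_of_mem hk (u := eta Kx Ky) ⟨by linarith [hη.1], hη.2⟩
  have hs2 := sn_neg_of_mem hk (u := 2 * eta Kx Ky) ⟨by linarith [hη.1], by linarith [hη.2]⟩
  have hc1 := cn_pos hk (u := eta Kx Ky) ⟨by linarith [hη.1], by linarith [hη.2]⟩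
  have hc2 := cn_pos hk (u := 2 * eta Kx Ky) ⟨by linarith [hη.1], by linarith [hη.2]⟩
  have qc2 := cn_sq (√(1 - modulus Kx Ky ^ 2)) (2 * eta Kx Ky)
  have qd2 := dn_sq hk (2 * eta Kx Ky)
  have hd2 := dn_pos hk (2 * eta Kx Ky)
  have hsq := compl_modulus_sq hKx hKy
  have hD := addition_denom_pos hk (eta Kx Ky) (eta Kx Ky)
  have m1 := sn_two_mul hk (eta Kx Ky)
  have m2 := cn_two_mul hk (eta Kx Ky)
  have m3 := dn_two_mul hk (eta Kx Ky)
  have qd1 := dn_sq hk (eta Kx Ky)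
  rw [hsq] at qd1 qd2 hD m1 m2 m3
  have hd := dual_pos hKx
  have hS : Real.sinh (2 * dual Kx) =
      -cn (√(1 - modulus Kx Ky ^ 2)) (2 * eta Kx Ky) /
        sn (√(1 - modulus Kx Ky ^ 2)) (2 * eta Kx Ky) := by
    have := sinh_two_mul_dual hKx
    rw [hA] at this
    have := hs2.ne
    have := hc2.ne'
    field_simp at *
    linarith
  have hSy : Real.sinh (2 * Ky) = Real.sinh (2 * dual Kx) / modulus Kx Ky := by
    have h1 : Real.sinh (2 * dual Kx) ≠ 0 := (Real.sinh_pos_iff.2 (by linarith)).ne'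
    rw [modulus, div_div_cancel₀ h1]
  have hSy' : Real.sinh (2 * Ky) = -cn (√(1 - modulus Kx Ky ^ 2)) (2 * eta Kx Ky) /
      (modulus Kx Ky * sn (√(1 - modulus Kx Ky ^ 2)) (2 * eta Kx Ky)) := by
    rw [hSy, hS, div_div, mul_comm (modulus Kx Ky)]
  refine ⟨hk0, modulus_lt_one hKx hKy, hs1, hc1, dn_pos hk _, hs2, hc2, hd2,
    cn_sq _ _, qd1, qc2, qd2, by linarith, m1, m2, m3, hS, ?_, hSy', ?_⟩
  · refine (sq_eq_sq₀ (Real.cosh_pos _).le (div_nonneg_of_nonpos (by norm_num) hs2.le)).1 ?_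
    rw [Real.cosh_sq, hS, div_pow, div_pow, neg_sq, qc2]
    have := hs2.ne
    field_simp
    ring
  · refine (sq_eq_sq₀ (Real.cosh_pos _).le
      (div_nonneg_of_nonpos (by linarith) (mul_nonpos_of_nonneg_of_nonpos hk0.le hs2.le))).1 ?_
    rw [Real.cosh_sq, hSy', div_pow, div_pow, neg_sq, neg_sq, qc2, qd2]
    have := hs2.ne
    field_simp
    ring

/-! ### Algebraic identities between values at `u`, `η` and `2η` -/

namespace EtaValues

variable {Kx Ky k s₁ c₁ d₁ s₂ c₂ d₂ : ℝ} (h : EtaValues Kx Ky k s₁ c₁ d₁ s₂ c₂ d₂)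
include h

theorem k_sq_lt_one : k ^ 2 < 1 := by nlinarith [h.k_pos, h.k_lt_one]

theorem tanh_dual : Real.tanh (dual Kx) = c₂ / (1 - s₂) := by
  have h1 := h.s₂_neg
  have h2 : s₂ - 1 ≠ 0 := by linarith
  have h3 : 1 - s₂ ≠ 0 := by linarith
  have h4 := h1.ne
  rw [tanh_eq_sinh_two_mul_div, h.sinh_dual, h.cosh_dual,
    show 1 + -1 / s₂ = (s₂ - 1) / s₂ by field_simp; ring]
  field_simp
  ring

theorem tanh_Ky : Real.tanh Ky = c₂ / (d₂ - k * s₂) := by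
  have h1 := h.s₂_neg
  have h2 := h.d₂_pos
  have h0 := h.k_pos
  have h5 : k * s₂ < 0 := mul_neg_of_pos_of_neg h0 h1
  have h3 : d₂ - k * s₂ ≠ 0 := by linarith
  have h6 : k * s₂ - d₂ ≠ 0 := by linarith
  have h4 := h1.ne
  rw [tanh_eq_sinh_two_mul_div, h.sinh_Ky, h.cosh_Ky,
    show 1 + -d₂ / (k * s₂) = (k * s₂ - d₂) / (k * s₂) by field_simp; ring]
  field_simp
  ring

theorem alpha_eq : alpha Kx Ky = (d₂ - k * s₂) / (1 - s₂) := by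
  have h1 := h.c₂_pos.ne'
  rw [alpha, h.tanh_dual, h.tanh_Ky]
  field_simp

theorem beta_eq : beta Kx Ky = (d₂ + k * s₂) / (1 - s₂) := by
  have h5 : k * s₂ < 0 := mul_neg_of_pos_of_neg h.k_pos h.s₂_neg
  have h3 : d₂ - k * s₂ ≠ 0 := by linarith [h.d₂_pos]
  have h4 : 1 - s₂ ≠ 0 := by linarith [h.s₂_neg]
  rw [beta, h.tanh_dual, h.tanh_Ky, div_mul_div_comm, div_eq_div_iff (mul_ne_zero h4 h3) h4]
  -- The point is `(d₂ - k s₂)(d₂ + k s₂) = 1 - s₂² = c₂²`.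
  linear_combination (1 - s₂) * (h.c₂_sq - h.d₂_sq)

end EtaValues

namespace EtaValues

variable {Kx Ky k s₁ c₁ d₁ s₂ c₂ d₂ : ℝ} (h : EtaValues Kx Ky k s₁ c₁ d₁ s₂ c₂ d₂)
include h

/-- The product of this factor with `1 - (1 - k) s₁²` is `c₂` times the positive duplication
denominator. So the bound `η > -K'/2`, which makes `c₂` positive, is what is used here. It yields `λ
> 1`. -/
theorem factor_pos : 0 < c₁ ^ 2 - k * s₁ ^ 2 := by
  have h1 : 0 < (c₁ ^ 2 - k * s₁ ^ 2) * (1 - (1 - k) * s₁ ^ 2) := by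
    have h2 := mul_pos h.c₂_pos h.denom_pos
    rw [h.c₂_mul, h.d₁_sq, h.c₁_sq] at h2
    rw [h.c₁_sq]
    linear_combination h2
  have h3 : 0 < 1 - (1 - k) * s₁ ^ 2 := by
    have := h.c₁_sq
    nlinarith [h.k_pos, h.k_lt_one, pow_pos h.c₁_pos 2, sq_nonneg s₁]
  exact pos_of_mul_pos_left h1 h3.le

theorem numerator_pos (s : ℝ) : 0 < s ^ 2 * c₁ ^ 2 + s₁ ^ 2 := by
  have := sq_pos_of_neg h.s₁_neg
  positivity

theorem denominator_pos (s : ℝ) : 0 < c₁ ^ 2 + k ^ 2 * s ^ 2 * s₁ ^ 2 := by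
  have := h.c₁_pos
  positivity

variable {s c d : ℝ} (hc : c ^ 2 = 1 - s ^ 2) (hd : d ^ 2 = 1 - k ^ 2 * s ^ 2)
include hc hd

theorem normSq_eq : (s * d₁) ^ 2 + (c * d * s₁ * c₁) ^ 2 =
    (s ^ 2 * c₁ ^ 2 + s₁ ^ 2) * (c₁ ^ 2 + k ^ 2 * s ^ 2 * s₁ ^ 2) := by
  simp only [mul_pow, hc, hd, h.c₁_sq, h.d₁_sq]
  ring

theorem normSq_pos : 0 < (s * d₁) ^ 2 + (c * d * s₁ * c₁) ^ 2 := by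
  rw [h.normSq_eq hc hd]
  exact mul_pos (h.numerator_pos s) (h.denominator_pos s)

omit hd in
theorem one_lt_ratio :
    1 < (c₁ ^ 2 + k ^ 2 * s ^ 2 * s₁ ^ 2) / (k * (s ^ 2 * c₁ ^ 2 + s₁ ^ 2)) := by
  rw [one_lt_div (mul_pos h.k_pos (h.numerator_pos s))]
  have h1 : s ^ 2 ≤ 1 := by nlinarith [sq_nonneg c]
  have h2 : 0 < 1 - k * s ^ 2 := by nlinarith [h.k_pos, h.k_lt_one, sq_nonneg s]
  -- Numerator minus denominator factors as `(c₁² - k s₁²)(1 - k s²)`.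
  nlinarith [mul_pos h.factor_pos h2]

/-- The dispersion relation in elliptic form. -/
theorem dispersion {x : ℝ}
    (hx : x * ((s * d₁) ^ 2 + (c * d * s₁ * c₁) ^ 2) = (s * d₁) ^ 2 - (c * d * s₁ * c₁) ^ 2) :
    Real.cosh (2 * dual Kx) * Real.cosh (2 * Ky) - Real.sinh (2 * dual Kx) * Real.sinh (2 * Ky) * x
      = ((c₁ ^ 2 + k ^ 2 * s ^ 2 * s₁ ^ 2) / (k * (s ^ 2 * c₁ ^ 2 + s₁ ^ 2)) +
        ((c₁ ^ 2 + k ^ 2 * s ^ 2 * s₁ ^ 2) / (k * (s ^ 2 * c₁ ^ 2 + s₁ ^ 2)))⁻¹) / 2 := by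
  have hW := h.normSq_eq hc hd
  have hP := (h.numerator_pos s).ne'
  have hQ := (h.denominator_pos s).ne'
  have hk := h.k_pos.ne'
  have hs₂ := h.s₂_neg.ne
  have hD := h.denom_pos.ne'
  -- This is the claim with denominators cleared. Multiplying by the square of the duplication
  -- denominator removes `s₂, c₂, d₂` and leaves a polynomial identity in `s²`, `s₁²` and `k`.
  have key : 2 * (d₂ * ((s * d₁) ^ 2 + (c * d * s₁ * c₁) ^ 2) -
      c₂ ^ 2 * ((s * d₁) ^ 2 - (c * d * s₁ * c₁) ^ 2)) =
      ((c₁ ^ 2 + k ^ 2 * s ^ 2 * s₁ ^ 2) ^ 2 + k ^ 2 * (s ^ 2 * c₁ ^ 2 + s₁ ^ 2) ^ 2) * s₂ ^ 2 := by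
    refine mul_right_cancel₀ (pow_ne_zero 2 hD) ?_
    have e1 : s₂ ^ 2 * (1 - (1 - k ^ 2) * s₁ ^ 4) ^ 2 = 4 * s₁ ^ 2 * c₁ ^ 2 * d₁ ^ 2 := by
      rw [← mul_pow, h.s₂_mul]; ring
    have e2 : c₂ ^ 2 * (1 - (1 - k ^ 2) * s₁ ^ 4) ^ 2 = (c₁ ^ 2 - s₁ ^ 2 * d₁ ^ 2) ^ 2 := by
      rw [← mul_pow, h.c₂_mul]
    have e3 := h.d₂_mul
    rw [mul_assoc _ (s₂ ^ 2), e1]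
    have : 2 * (d₂ * ((s * d₁) ^ 2 + (c * d * s₁ * c₁) ^ 2) -
        c₂ ^ 2 * ((s * d₁) ^ 2 - (c * d * s₁ * c₁) ^ 2)) * (1 - (1 - k ^ 2) * s₁ ^ 4) ^ 2 =
        2 * (d₂ * (1 - (1 - k ^ 2) * s₁ ^ 4) * (1 - (1 - k ^ 2) * s₁ ^ 4) *
          ((s * d₁) ^ 2 + (c * d * s₁ * c₁) ^ 2) -
        c₂ ^ 2 * (1 - (1 - k ^ 2) * s₁ ^ 4) ^ 2 * ((s * d₁) ^ 2 - (c * d * s₁ * c₁) ^ 2)) := by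
      ring
    rw [this, e2, e3]
    simp only [mul_pow, hc, hd, h.c₁_sq, h.d₁_sq]
    ring
  rw [← hx] at key
  rw [h.sinh_dual, h.cosh_dual, h.sinh_Ky, h.cosh_Ky]
  generalize (s * d₁) ^ 2 + (c * d * s₁ * c₁) ^ 2 = W at *
  generalize s ^ 2 * c₁ ^ 2 + s₁ ^ 2 = P at *
  generalize c₁ ^ 2 + k ^ 2 * s ^ 2 * s₁ ^ 2 = Q at *
  subst hW
  field_simp
  linear_combination key

/-- For `λ = Q/(kP)`, both `Q² - k²P²` and the claimed product equal `(c₁⁴ - k² s₁⁴)(1 - k² s⁴)`.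
The result shows `sinh γ` as a constant times a quotient of two squared lengths, so its square root
splits off explicitly in the kernels. -/
theorem sinh_log_ratio :
    Real.sinh (Real.log ((c₁ ^ 2 + k ^ 2 * s ^ 2 * s₁ ^ 2) / (k * (s ^ 2 * c₁ ^ 2 + s₁ ^ 2)))) =
      c₂ * (1 - (1 - k ^ 2) * s₁ ^ 4) / (2 * k) *
        ((d ^ 2 + (k * s * c) ^ 2) / ((s * d₁) ^ 2 + (c * d * s₁ * c₁) ^ 2)) := by
  have hP := (h.numerator_pos s).ne'
  have hQ := (h.denominator_pos s).ne'
  have hk := h.k_pos.ne'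
  rw [Real.sinh_log (one_pos.trans (h.one_lt_ratio hc)), h.c₂_mul, h.normSq_eq hc hd]
  have key : (c₁ ^ 2 - s₁ ^ 2 * d₁ ^ 2) * (d ^ 2 + (k * s * c) ^ 2) =
      (c₁ ^ 2 + k ^ 2 * s ^ 2 * s₁ ^ 2) ^ 2 - k ^ 2 * (s ^ 2 * c₁ ^ 2 + s₁ ^ 2) ^ 2 := by
    simp only [mul_pow, hc, hd, h.c₁_sq, h.d₁_sq]
    ring
  generalize s ^ 2 * c₁ ^ 2 + s₁ ^ 2 = P at *
  generalize c₁ ^ 2 + k ^ 2 * s ^ 2 * s₁ ^ 2 = Q at *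
  field_simp
  linear_combination -key

/-- Real part of `(1 - α z)(1 - β / z)`. -/
theorem symbol_re :
    (1 + alpha Kx Ky * beta Kx Ky) * ((s * d₁) ^ 2 + (c * d * s₁ * c₁) ^ 2) -
      (alpha Kx Ky + beta Kx Ky) * ((s * d₁) ^ 2 - (c * d * s₁ * c₁) ^ 2) =
    2 * (s₁ * c₁) ^ 2 * (1 + d₂) / (1 - s₂) * (d ^ 2 - (k * s * c) ^ 2) := by
  have hs₂ : 1 - s₂ ≠ 0 := by linarith [h.s₂_neg]
  have hD := h.denom_pos.ne'
  -- What remains once `1 + αβ = 2/(1 - s₂)` and `α + β = 2d₂/(1 - s₂)` are inserted.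
  have key : ((s * d₁) ^ 2 + (c * d * s₁ * c₁) ^ 2) - d₂ * ((s * d₁) ^ 2 - (c * d * s₁ * c₁) ^ 2) =
      (s₁ * c₁) ^ 2 * (1 + d₂) * (d ^ 2 - (k * s * c) ^ 2) := by
    refine mul_right_cancel₀ hD ?_
    have e : d₂ * (1 - (1 - k ^ 2) * s₁ ^ 4) =
        1 - (1 - k ^ 2) * s₁ ^ 2 - (1 - k ^ 2) * s₁ ^ 2 * (1 - s₁ ^ 2) := by
      rw [h.d₂_mul, h.d₁_sq, h.c₁_sq]
    simp only [mul_pow, hc, hd, h.c₁_sq, h.d₁_sq]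
    linear_combination (-(s ^ 2 * (1 - (1 - k ^ 2) * s₁ ^ 2) -
      (1 - s ^ 2) * (1 - k ^ 2 * s ^ 2) * s₁ ^ 2 * (1 - s₁ ^ 2)) -
      s₁ ^ 2 * (1 - s₁ ^ 2) * (1 - k ^ 2 * s ^ 2 - k ^ 2 * s ^ 2 * (1 - s ^ 2))) * e
  have e1 : alpha Kx Ky + beta Kx Ky = 2 * d₂ / (1 - s₂) := by
    rw [h.alpha_eq, h.beta_eq]; ring
  have e2 : 1 + alpha Kx Ky * beta Kx Ky = 2 / (1 - s₂) := by
    rw [h.alpha_eq, h.beta_eq]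
    field_simp
    linear_combination h.d₂_sq
  rw [e1, e2]
  field_simp
  linear_combination key

omit hc hd in
/-- Imaginary part of `(1 - α z)(1 - β / z)`. -/
theorem symbol_im :
    -(alpha Kx Ky - beta Kx Ky) * ((s * d₁) * (c * d * s₁ * c₁)) =
    2 * (s₁ * c₁) ^ 2 * (1 + d₂) / (1 - s₂) * (d * (k * s * c)) := by
  have hs₂ : 1 - s₂ ≠ 0 := by linarith [h.s₂_neg]
  have hD := h.denom_pos.ne'
  have key : s₂ * d₁ = s₁ * c₁ * (1 + d₂) := by
    refine mul_right_cancel₀ hD ?_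
    have e := h.d₂_mul
    have e' := h.s₂_mul
    have e1 := h.d₁_sq
    have e2 := h.c₁_sq
    linear_combination d₁ * e' - s₁ * c₁ * e + s₁ * c₁ * e1 + s₁ ^ 3 * c₁ * (1 - k ^ 2) * e2
  have e1 : alpha Kx Ky - beta Kx Ky = -2 * k * s₂ / (1 - s₂) := by
    rw [h.alpha_eq, h.beta_eq]; ring
  rw [e1]
  field_simp
  linear_combination k * s * c * d * s₁ * c₁ * key

end EtaValues

/-! ### Elliptic parametrization of the spectral curve -/

section Spectral

variable {Kx Ky : ℝ}

/-- Real part of a complex number in the direction of `e^{iθ/2}`; see `zMap_eq`. -/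
def halfRe (Kx Ky u : ℝ) : ℝ :=
  -(sn (modulus Kx Ky) u * dn (√(1 - modulus Kx Ky ^ 2)) (eta Kx Ky))

/-- Imaginary part of a complex number in the direction of `e^{iθ/2}`; see `zMap_eq`. -/
def halfIm (Kx Ky u : ℝ) : ℝ :=
  -(cn (modulus Kx Ky) u * dn (modulus Kx Ky) u * sn (√(1 - modulus Kx Ky ^ 2)) (eta Kx Ky) *
    cn (√(1 - modulus Kx Ky ^ 2)) (eta Kx Ky))

/-- The modulus of `halfRe + i halfIm`. -/
def halfAbs (Kx Ky u : ℝ) : ℝ := √(halfRe Kx Ky u ^ 2 + halfIm Kx Ky u ^ 2)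

/-- The closed form of `λ(u)` at real `u`. -/
def lamRatio (Kx Ky u : ℝ) : ℝ :=
  (cn (√(1 - modulus Kx Ky ^ 2)) (eta Kx Ky) ^ 2 +
    modulus Kx Ky ^ 2 * sn (modulus Kx Ky) u ^ 2 *
      sn (√(1 - modulus Kx Ky ^ 2)) (eta Kx Ky) ^ 2) /
  (modulus Kx Ky * (sn (modulus Kx Ky) u ^ 2 * cn (√(1 - modulus Kx Ky ^ 2)) (eta Kx Ky) ^ 2 +
    sn (√(1 - modulus Kx Ky ^ 2)) (eta Kx Ky) ^ 2))

variable (hKx : 0 < Kx) (hKy : dual Kx < Ky)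
include hKx hKy

theorem half_sq_pos (u : ℝ) : 0 < halfRe Kx Ky u ^ 2 + halfIm Kx Ky u ^ 2 := by
  have h := (etaValues hKx hKy).normSq_pos (cn_sq (modulus Kx Ky) u)
    (dn_sq (modulus_sq_lt_one hKx hKy) u)
  rwa [halfRe, halfIm, neg_sq, neg_sq]

theorem halfAbs_pos (u : ℝ) : 0 < halfAbs Kx Ky u := Real.sqrt_pos.2 (half_sq_pos hKx hKy u)

theorem halfAbs_sq (u : ℝ) :
    halfAbs Kx Ky u ^ 2 = halfRe Kx Ky u ^ 2 + halfIm Kx Ky u ^ 2 :=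
  Real.sq_sqrt (half_sq_pos hKx hKy u).le

omit hKx hKy in
theorem snC_add (u : ℝ) : snC (modulus Kx Ky) (u + I * eta Kx Ky) =
    -(halfRe Kx Ky u + I * halfIm Kx Ky u) /
      ((cn (√(1 - modulus Kx Ky ^ 2)) (eta Kx Ky) ^ 2 + modulus Kx Ky ^ 2 *
        sn (modulus Kx Ky) u ^ 2 * sn (√(1 - modulus Kx Ky ^ 2)) (eta Kx Ky) ^ 2 : ℝ) : ℂ) := by
  simp [snC, halfRe, halfIm]
  ring

theorem snC_sub (u : ℝ) : snC (modulus Kx Ky) (u - I * eta Kx Ky) =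
    -(halfRe Kx Ky u - I * halfIm Kx Ky u) /
      ((cn (√(1 - modulus Kx Ky ^ 2)) (eta Kx Ky) ^ 2 + modulus Kx Ky ^ 2 *
        sn (modulus Kx Ky) u ^ 2 * sn (√(1 - modulus Kx Ky ^ 2)) (eta Kx Ky) ^ 2 : ℝ) : ℂ) := by
  have hk := compl_modulus_sq_lt_one hKx hKy
  simp [snC, halfRe, halfIm, sn_neg hk, cn_neg hk, dn_neg hk]
  ring

theorem half_mul_conj (u : ℝ) :
    ((halfRe Kx Ky u : ℂ) + I * halfIm Kx Ky u) * (halfRe Kx Ky u - I * halfIm Kx Ky u) =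
      (halfAbs Kx Ky u : ℂ) ^ 2 := by
  have h : (halfAbs Kx Ky u : ℂ) ^ 2 = (halfRe Kx Ky u : ℂ) ^ 2 + (halfIm Kx Ky u : ℂ) ^ 2 := by
    exact_mod_cast halfAbs_sq hKx hKy u
  rw [h]
  linear_combination -(halfIm Kx Ky u : ℂ) ^ 2 * I_sq

/-- The values `sn(u ± iη)` are conjugate, and the quotient of a number by its conjugate is the
square of its direction. This is how half-angles enter. -/
theorem zMap_eq (u : ℝ) : zMap Kx Ky u =
    ((halfRe Kx Ky u + I * halfIm Kx Ky u) / halfAbs Kx Ky u) ^ 2 := by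
  have hQ : ((cn (√(1 - modulus Kx Ky ^ 2)) (eta Kx Ky) ^ 2 + modulus Kx Ky ^ 2 *
        sn (modulus Kx Ky) u ^ 2 * sn (√(1 - modulus Kx Ky ^ 2)) (eta Kx Ky) ^ 2 : ℝ) : ℂ) ≠ 0 :=
    Complex.ofReal_ne_zero.2 ((etaValues hKx hKy).denominator_pos _).ne'
  have hR : (halfAbs Kx Ky u : ℂ) ≠ 0 := Complex.ofReal_ne_zero.2 (halfAbs_pos hKx hKy u).ne'
  have hm := half_mul_conj hKx hKy u
  have hne := hm ▸ pow_ne_zero 2 hR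
  rw [zMap, snC_add, snC_sub hKx hKy, div_div_div_cancel_right₀ hQ, neg_div_neg_eq, div_pow,
    ← hm]
  have h1 := left_ne_zero_of_mul hne
  have h2 := right_ne_zero_of_mul hne
  field_simp

theorem lamMap_eq (u : ℝ) : lamMap Kx Ky u = (lamRatio Kx Ky u : ℝ) := by
  have h := etaValues hKx hKy
  have hQ : ((cn (√(1 - modulus Kx Ky ^ 2)) (eta Kx Ky) ^ 2 + modulus Kx Ky ^ 2 *
        sn (modulus Kx Ky) u ^ 2 * sn (√(1 - modulus Kx Ky ^ 2)) (eta Kx Ky) ^ 2 : ℝ) : ℂ) ≠ 0 :=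
    Complex.ofReal_ne_zero.2 (h.denominator_pos _).ne'
  have hP : ((sn (modulus Kx Ky) u ^ 2 * cn (√(1 - modulus Kx Ky ^ 2)) (eta Kx Ky) ^ 2 +
      sn (√(1 - modulus Kx Ky ^ 2)) (eta Kx Ky) ^ 2 : ℝ) : ℂ) ≠ 0 :=
    Complex.ofReal_ne_zero.2 (h.numerator_pos _).ne'
  have hk : (modulus Kx Ky : ℂ) ≠ 0 := Complex.ofReal_ne_zero.2 (modulus_pos hKx hKy).ne'
  have hm := half_mul_conj hKx hKy u
  rw [← Complex.ofReal_pow, halfAbs_sq hKx hKy, halfRe, halfIm, neg_sq, neg_sq,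
    h.normSq_eq (cn_sq (modulus Kx Ky) u) (dn_sq (modulus_sq_lt_one hKx hKy) u), ← halfRe,
    ← halfIm, Complex.ofReal_mul] at hm
  rw [lamMap, snC_add, snC_sub hKx hKy, lamRatio, Complex.ofReal_div, Complex.ofReal_mul]
  generalize ((cn (√(1 - modulus Kx Ky ^ 2)) (eta Kx Ky) ^ 2 + modulus Kx Ky ^ 2 *
        sn (modulus Kx Ky) u ^ 2 * sn (√(1 - modulus Kx Ky ^ 2)) (eta Kx Ky) ^ 2 : ℝ) : ℂ) = Q at *
  generalize ((sn (modulus Kx Ky) u ^ 2 * cn (√(1 - modulus Kx Ky ^ 2)) (eta Kx Ky) ^ 2 +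
      sn (√(1 - modulus Kx Ky ^ 2)) (eta Kx Ky) ^ 2 : ℝ) : ℂ) = P at *
  rw [mul_assoc, div_mul_div_comm, neg_mul_neg, hm]
  field_simp

/-- The points of the circle reached by `z` in trigonometric form. -/
theorem zMap_eq_exp_iff (u θ : ℝ) : zMap Kx Ky u = Complex.exp (I * θ) ↔
    Real.cos θ * halfAbs Kx Ky u ^ 2 = halfRe Kx Ky u ^ 2 - halfIm Kx Ky u ^ 2 ∧
    Real.sin θ * halfAbs Kx Ky u ^ 2 = 2 * halfRe Kx Ky u * halfIm Kx Ky u := by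
  have hR : (halfAbs Kx Ky u : ℂ) ≠ 0 := Complex.ofReal_ne_zero.2 (halfAbs_pos hKx hKy u).ne'
  rw [zMap_eq hKx hKy, div_pow, div_eq_iff (pow_ne_zero 2 hR), mul_comm I (θ : ℂ), Complex.exp_mul_I,
    ← Complex.ofReal_cos, ← Complex.ofReal_sin, ← Complex.ofReal_pow]
  have e : ((halfRe Kx Ky u : ℂ) + I * halfIm Kx Ky u) ^ 2 =
      ((halfRe Kx Ky u ^ 2 - halfIm Kx Ky u ^ 2 : ℝ) : ℂ) +
        ((2 * halfRe Kx Ky u * halfIm Kx Ky u : ℝ) : ℂ) * I := by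
    push_cast
    linear_combination (halfIm Kx Ky u : ℂ) ^ 2 * I_sq
  rw [e, Complex.ext_iff]
  simp only [Complex.add_re, Complex.add_im, Complex.mul_re, Complex.mul_im, Complex.ofReal_re,
    Complex.ofReal_im, Complex.I_re, Complex.I_im]
  constructor
  · rintro ⟨h1, h2⟩; constructor <;> linarith
  · rintro ⟨h1, h2⟩; constructor <;> linarith

/-- The dispersion relation gives `cosh γ = cosh(log λ)`, and `λ > 1` makes `log λ` the nonnegative
solution. Hence the second defining equation of `u_θ` follows from the first. -/
theorem gam_eq_log {u θ : ℝ} (hz : zMap Kx Ky u = Complex.exp (I * θ)) :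
    gam Kx Ky θ = Real.log (lamRatio Kx Ky u) := by
  have h := etaValues hKx hKy
  have hc := cn_sq (modulus Kx Ky) u
  have hd := dn_sq (modulus_sq_lt_one hKx hKy) u
  have h1 := h.one_lt_ratio hc
  have hz' := ((zMap_eq_exp_iff hKx hKy u θ).1 hz).1
  rw [halfAbs_sq hKx hKy, halfRe, halfIm, neg_sq, neg_sq] at hz'
  rw [gam, h.dispersion hc hd hz']
  change Real.arcosh ((lamRatio Kx Ky u + (lamRatio Kx Ky u)⁻¹) / 2) = _
  change 1 < lamRatio Kx Ky u at h1
  rw [← Real.cosh_log (one_pos.trans h1), Real.arcosh_cosh (Real.log_pos h1).le]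

theorem lamMap_eq_exp {u θ : ℝ} (hz : zMap Kx Ky u = Complex.exp (I * θ)) :
    lamMap Kx Ky u = Real.exp (gam Kx Ky θ) := by
  have h1 : 1 < lamRatio Kx Ky u := (etaValues hKx hKy).one_lt_ratio (cn_sq (modulus Kx Ky) u)
  rw [gam_eq_log hKx hKy hz, Real.exp_log (one_pos.trans h1), lamMap_eq hKx hKy]

/-- The minus signs in `halfRe` and `halfIm` compensate `s₁ < 0`. They put the vector in the closed
upper half-plane, where `θ/2 ∈ [0, π)` lives. -/
theorem halfIm_nonneg {u : ℝ}
    (hu : u ∈ Set.Ico (-ellipticK (modulus Kx Ky)) (ellipticK (modulus Kx Ky))) :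
    0 ≤ halfIm Kx Ky u := by
  have h := etaValues hKx hKy
  have hk := modulus_sq_lt_one hKx hKy
  have hc : 0 ≤ cn (modulus Kx Ky) u := by
    rcases hu.1.eq_or_lt with h0 | h0
    · rw [← h0, cn_neg hk, cn_ellipticK hk]
    · exact (cn_pos hk ⟨h0, hu.2⟩).le
  rw [halfIm, mul_assoc _ (sn _ _), ← mul_neg]
  refine mul_nonneg (mul_nonneg hc (dn_pos hk u).le) ?_
  exact neg_nonneg.2 (mul_nonpos_of_nonpos_of_nonneg h.s₁_neg.le h.c₁_pos.le)

theorem halfRe_neg_ellipticK :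
    halfRe Kx Ky (-ellipticK (modulus Kx Ky)) =
      dn (√(1 - modulus Kx Ky ^ 2)) (eta Kx Ky) := by
  have hk := modulus_sq_lt_one hKx hKy
  rw [halfRe, sn_neg hk, sn_ellipticK hk]; ring

theorem halfRe_ellipticK :
    halfRe Kx Ky (ellipticK (modulus Kx Ky)) =
      -dn (√(1 - modulus Kx Ky ^ 2)) (eta Kx Ky) := by
  have hk := modulus_sq_lt_one hKx hKy
  rw [halfRe, sn_ellipticK hk]; ring

theorem halfIm_neg_ellipticK : halfIm Kx Ky (-ellipticK (modulus Kx Ky)) = 0 := by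
  have hk := modulus_sq_lt_one hKx hKy
  rw [halfIm, cn_neg hk, cn_ellipticK hk]; ring

theorem halfIm_ellipticK : halfIm Kx Ky (ellipticK (modulus Kx Ky)) = 0 := by
  have hk := modulus_sq_lt_one hKx hKy
  rw [halfIm, cn_ellipticK hk]; ring

/-- `halfRe + i halfIm` points in the direction of `e^{iθ/2}`. -/
theorem half_eq {u θ : ℝ} (hθ : θ ∈ Set.Ico (0 : ℝ) (2 * π))
    (hu : u ∈ Set.Ico (-ellipticK (modulus Kx Ky)) (ellipticK (modulus Kx Ky)))
    (hz : zMap Kx Ky u = Complex.exp (I * θ)) :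
    halfRe Kx Ky u = halfAbs Kx Ky u * Real.cos (θ / 2) ∧
      halfIm Kx Ky u = halfAbs Kx Ky u * Real.sin (θ / 2) := by
  have h := etaValues hKx hKy
  have hk := modulus_sq_lt_one hKx hKy
  have hY := halfIm_nonneg hKx hKy hu
  have hR := halfAbs_pos hKx hKy u
  have hR2 := halfAbs_sq hKx hKy u
  obtain ⟨h1, h2⟩ := (zMap_eq_exp_iff hKx hKy u θ).1 hz
  have hcs := Real.sin_sq_add_cos_sq (θ / 2)
  rw [show θ = 2 * (θ / 2) by ring, Real.cos_two_mul] at h1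
  rw [show θ = 2 * (θ / 2) by ring, Real.sin_two_mul] at h2
  have hX2 : halfRe Kx Ky u ^ 2 = (halfAbs Kx Ky u * Real.cos (θ / 2)) ^ 2 := by linarith
  have hY2 : halfIm Kx Ky u ^ 2 = (halfAbs Kx Ky u * Real.sin (θ / 2)) ^ 2 := by
    linear_combination (h1 - hR2) / 2 - halfAbs Kx Ky u ^ 2 * hcs
  have hs : 0 ≤ Real.sin (θ / 2) :=
    Real.sin_nonneg_of_nonneg_of_le_pi (by linarith [hθ.1]) (by linarith [hθ.2])
  have hYe : halfIm Kx Ky u = halfAbs Kx Ky u * Real.sin (θ / 2) :=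
    (sq_eq_sq₀ hY (mul_nonneg hR.le hs)).1 hY2
  refine ⟨?_, hYe⟩
  -- For `θ = 0` the imaginary part vanishes, which forces `u = -K` and gives the sign of the real
  -- part. Otherwise that sign is read off from the product of the two parts, which is known from
  -- `sin θ`.
  rcases hθ.1.eq_or_lt with h0 | h0
  · have hY0 : halfIm Kx Ky u = 0 := by rw [hYe, ← h0]; simp
    have hu' : u = -ellipticK (modulus Kx Ky) := by
      by_contra hne
      have hc := cn_pos hk ⟨lt_of_le_of_ne hu.1 (Ne.symm hne), hu.2⟩
      rw [halfIm, neg_eq_zero] at hY0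
      exact mul_ne_zero (mul_ne_zero (mul_ne_zero hc.ne' (dn_pos hk u).ne') h.s₁_neg.ne)
        h.c₁_pos.ne' hY0
    have hX : 0 ≤ halfRe Kx Ky u := by
      rw [hu', halfRe_neg_ellipticK hKx hKy]; exact h.d₁_pos.le
    refine (sq_eq_sq₀ hX (mul_nonneg hR.le ?_)).1 hX2
    rw [← h0]; simp
  · have hs' : 0 < Real.sin (θ / 2) :=
      Real.sin_pos_of_pos_of_lt_pi (by linarith) (by linarith [hθ.2])
    have : halfIm Kx Ky u ≠ 0 := by rw [hYe]; positivity
    refine mul_right_cancel₀ this ?_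
    rw [hYe]
    rw [hYe] at h2
    linear_combination -h2 / 2

theorem exists_isU {θ : ℝ} (hθ : θ ∈ Set.Ico (0 : ℝ) (2 * π)) : ∃ u, IsU Kx Ky θ u := by
  have h := etaValues hKx hKy
  have hk := modulus_sq_lt_one hKx hKy
  have hK := ellipticK_pos hk
  have key : ∃ u ∈ Set.Ico (-ellipticK (modulus Kx Ky)) (ellipticK (modulus Kx Ky)),
      halfRe Kx Ky u * Real.sin (θ / 2) = halfIm Kx Ky u * Real.cos (θ / 2) := by
    rcases hθ.1.eq_or_lt with h0 | h0
    · refine ⟨-ellipticK (modulus Kx Ky), ⟨le_rfl, by linarith⟩, ?_⟩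
      rw [halfIm_neg_ellipticK hKx hKy, ← h0]; simp
    · have hs' : 0 < Real.sin (θ / 2) :=
        Real.sin_pos_of_pos_of_lt_pi (by linarith) (by linarith [hθ.2])
      -- This cross product with `e^{iθ/2}` goes from `d₁ sin(θ/2) > 0` at `-K` to its negative at
      -- `K`. So it has a zero, and the zero is not `K`.
      have hcont : Continuous fun u =>
          halfRe Kx Ky u * Real.sin (θ / 2) - halfIm Kx Ky u * Real.cos (θ / 2) := by
        have hS : Continuous (sn (modulus Kx Ky)) :=
          continuous_iff_continuousAt.2 fun x => (hasDerivAt_sn hk x).continuousAt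
        have hC : Continuous (cn (modulus Kx Ky)) :=
          continuous_iff_continuousAt.2 fun x => (hasDerivAt_cn hk x).continuousAt
        have hD : Continuous (dn (modulus Kx Ky)) :=
          continuous_iff_continuousAt.2 fun x => (hasDerivAt_dn hk x).continuousAt
        unfold halfRe halfIm
        fun_prop
      have hlo := mul_pos h.d₁_pos hs'
      obtain ⟨u, hu, hu0⟩ := intermediate_value_Icc'
        (a := -ellipticK (modulus Kx Ky)) (b := ellipticK (modulus Kx Ky)) (by linarith) hcont.continuousOn
        (show (0 : ℝ) ∈ Set.Icc _ _ by
          rw [halfIm_ellipticK hKx hKy, halfIm_neg_ellipticK hKx hKy, halfRe_ellipticK hKx hKy,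
            halfRe_neg_ellipticK hKx hKy]
          constructor <;> linarith)
      refine ⟨u, ⟨hu.1, lt_of_le_of_ne hu.2 ?_⟩, sub_eq_zero.1 hu0⟩
      rintro rfl
      simp only [halfIm_ellipticK hKx hKy, halfRe_ellipticK hKx hKy] at hu0
      linarith
  obtain ⟨u, hu, hXY⟩ := key
  have hz : zMap Kx Ky u = Complex.exp (I * θ) := by
    have e1 := Real.cos_two_mul (θ / 2)
    have e2 := Real.sin_two_mul (θ / 2)
    rw [mul_div_cancel₀ _ two_ne_zero] at e1 e2
    rw [zMap_eq_exp_iff hKx hKy, halfAbs_sq hKx hKy, e1, e2]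
    have hcs := Real.sin_sq_add_cos_sq (θ / 2)
    generalize Real.sin (θ / 2) = S at *
    generalize Real.cos (θ / 2) = C at *
    generalize halfRe Kx Ky u = X at *
    generalize halfIm Kx Ky u = Y at *
    constructor
    · linear_combination (X * S + Y * C) * -2 * hXY + 2 * X ^ 2 * hcs
    · linear_combination (2 * X * C - 2 * S * Y) * hXY + 2 * X * Y * hcs
  exact ⟨u, hu, hz, lamMap_eq_exp hKx hKy hz⟩

theorem isU_unique {θ u v : ℝ} (hθ : θ ∈ Set.Ico (0 : ℝ) (2 * π)) (hu : IsU Kx Ky θ u)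
    (hv : IsU Kx Ky θ v) : u = v := by
  have h := etaValues hKx hKy
  have hk := modulus_sq_lt_one hKx hKy
  obtain ⟨h1, h2⟩ := half_eq hKx hKy hθ hu.1 hu.2.1
  obtain ⟨h3, h4⟩ := half_eq hKx hKy hθ hv.1 hv.2.1
  -- The two half-vectors are parallel. Their cross product is `s₁ c₁ d₁` times the numerator of
  -- `sn(u - v)`, and `|u - v| < 2K`.
  have hXY : halfRe Kx Ky u * halfIm Kx Ky v = halfRe Kx Ky v * halfIm Kx Ky u := by
    rw [h1, h2, h3, h4]; ring
  have hne := mul_ne_zero (mul_ne_zero h.d₁_pos.ne' h.s₁_neg.ne) h.c₁_pos.ne'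
  have hn : sn (modulus Kx Ky) (u - v) = 0 := by
    rw [sn_sub hk, div_eq_zero_iff]
    left
    refine mul_left_cancel₀ hne ?_
    rw [halfRe, halfIm, halfRe, halfIm] at hXY
    linear_combination hXY
  have := eq_zero_of_sn_eq_zero hk (u := u - v) (by linarith [hu.1.1, hv.1.2])
    (by linarith [hu.1.2, hv.1.1]) hn
  linarith

theorem existsUnique_isU {θ : ℝ} (hθ : θ ∈ Set.Ico (0 : ℝ) (2 * π)) : ∃! u, IsU Kx Ky θ u := by
  obtain ⟨u, hu⟩ := exists_isU hKx hKy hθ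
  exact ⟨u, hu, fun v hv => isU_unique hKx hKy hθ hv hu⟩

theorem isU_uu {θ : ℝ} (hθ : θ ∈ Set.Ico (0 : ℝ) (2 * π)) : IsU Kx Ky θ (uu Kx Ky θ) :=
  Classical.epsilon_spec (exists_isU hKx hKy hθ)

end Spectral

/-! ### Square roots of `b` as unit vectors; choice of branches -/

theorem sqrt_sq_of_re_pos {z : ℂ} (hz : 0 < z.re) : Complex.sqrt (z ^ 2) = z :=
  Complex.sq_cpow_two_inv hz

/-- `dn² + k² sn² cn²`. -/
def rootNorm (k u : ℝ) : ℝ := dn k u ^ 2 + (k * sn k u * cn k u) ^ 2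

/-- Real part of `√b` in terms of the elliptic parameter. -/
def rootRe (k u : ℝ) : ℝ := dn k u / √(rootNorm k u)

/-- Imaginary part of `√b` in terms of the elliptic parameter. -/
def rootIm (k u : ℝ) : ℝ := k * sn k u * cn k u / √(rootNorm k u)

theorem rootNorm_pos {k : ℝ} (hk : k ^ 2 < 1) (u : ℝ) : 0 < rootNorm k u := by
  have := dn_pos hk u
  unfold rootNorm
  positivity

theorem rootRe_sq_add {k : ℝ} (hk : k ^ 2 < 1) (u : ℝ) : rootRe k u ^ 2 + rootIm k u ^ 2 = 1 := by
  rw [rootRe, rootIm, div_pow, div_pow, Real.sq_sqrt (rootNorm_pos hk u).le, ← add_div, ← rootNorm,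
    div_self (rootNorm_pos hk u).ne']

/-- `d² - k²s²c² = (1 - k²) + k²(1 - s²)² > 0`. The unit vectors thus have argument strictly between
`-π/4` and `π/4`. Products of two of them, or of one with the conjugate of another, have positive
real part, so the principal square roots are multiplicative here. -/
theorem abs_rootIm_lt {k : ℝ} (hk : k ^ 2 < 1) (u : ℝ) : |rootIm k u| < rootRe k u := by
  rw [rootIm, rootRe, abs_div, abs_of_pos (Real.sqrt_pos.2 (rootNorm_pos hk u))]
  refine div_lt_div_of_pos_right (abs_lt_of_sq_lt_sq ?_ (dn_pos hk u).le)
    (Real.sqrt_pos.2 (rootNorm_pos hk u))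
  rw [mul_pow, mul_pow, cn_sq, dn_sq hk]
  have h1 := sn_sq_le_one k u
  generalize sn k u ^ 2 = x at *
  nlinarith [mul_nonneg (sq_nonneg k) (sq_nonneg (1 - x))]

section UnitVectors

variable {p q p' q' : ℝ} (h : p ^ 2 + q ^ 2 = 1) (h' : p' ^ 2 + q' ^ 2 = 1)
  (hq : |q| < p) (hq' : |q'| < p')
include hq hq'

omit hq hq' in
theorem unit_mul_conj (h : p ^ 2 + q ^ 2 = 1) : ((p : ℂ) + I * q) * (p - I * q) = 1 := by
  have e : (p : ℂ) ^ 2 + (q : ℂ) ^ 2 = 1 := by exact_mod_cast h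
  linear_combination e - (q : ℂ) ^ 2 * I_sq

theorem abs_mul_lt : |q * q'| < p * p' := by
  rw [abs_mul]
  exact mul_lt_mul'' hq hq' (abs_nonneg _) (abs_nonneg _)

include h'

theorem sqrt_div_of_unit :
    Complex.sqrt (((p : ℂ) + I * q) ^ 2 / (p' + I * q') ^ 2) = (p + I * q) * (p' - I * q') := by
  have hne := left_ne_zero_of_mul (unit_mul_conj h' ▸ one_ne_zero :
    ((p' : ℂ) + I * q') * (p' - I * q') ≠ 0)
  have e : ((p : ℂ) + I * q) ^ 2 / (p' + I * q') ^ 2 = ((p + I * q) * (p' - I * q')) ^ 2 := by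
    rw [div_eq_iff (pow_ne_zero 2 hne)]
    have := unit_mul_conj h'
    linear_combination -((p : ℂ) + I * q) ^ 2 *
      (((p' : ℂ) + I * q') * (p' - I * q') + 1) * this
  rw [e, sqrt_sq_of_re_pos]
  have := (abs_lt.1 (abs_mul_lt hq hq')).1
  simp
  linarith

include h

theorem sqrt_div_add_sqrt_div :
    Complex.sqrt (((p : ℂ) + I * q) ^ 2 / (p' + I * q') ^ 2) +
      Complex.sqrt (((p' : ℂ) + I * q') ^ 2 / (p + I * q) ^ 2) =
        ((2 * (p * p' + q * q') : ℝ) : ℂ) := by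
  rw [sqrt_div_of_unit h' hq hq', sqrt_div_of_unit h hq' hq]
  push_cast
  linear_combination (-2 * (q : ℂ) * q') * I_sq

theorem sqrt_mul_sub_inv :
    Complex.sqrt (((p : ℂ) + I * q) ^ 2 * (p' + I * q') ^ 2) -
      1 / Complex.sqrt (((p : ℂ) + I * q) ^ 2 * (p' + I * q') ^ 2) =
        I * ((2 * (p * q' + q * p') : ℝ) : ℂ) := by
  have e : Complex.sqrt (((p : ℂ) + I * q) ^ 2 * (p' + I * q') ^ 2) =
      (p + I * q) * (p' + I * q') := by
    rw [← mul_pow, sqrt_sq_of_re_pos]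
    have := (abs_lt.1 (abs_mul_lt hq hq')).2
    simp
    linarith
  have e1 := unit_mul_conj h
  have e2 := unit_mul_conj h'
  have hinv : 1 / (((p : ℂ) + I * q) * (p' + I * q')) = (p - I * q) * (p' - I * q') := by
    rw [one_div]
    refine inv_eq_of_mul_eq_one_right ?_
    linear_combination (((p' : ℂ) + I * q') * (p' - I * q')) * e1 + e2
  rw [e, hinv]
  push_cast
  ring

end UnitVectors

/-! ### Elliptic form of the symbol and of the kernels -/

section Kernels

variable {Kx Ky : ℝ} (hKx : 0 < Kx) (hKy : dual Kx < Ky)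
include hKx hKy

/-- The case `ε = 1` is the numerator under the root in `b`, and `ε = -1` is its conjugate, the
denominator. The positive factor `G` is the same for both, so it cancels in the quotient. -/
theorem symbol_mul {u θ : ℝ} (hz : zMap Kx Ky u = Complex.exp (I * θ)) :
    ∃ G : ℝ, 0 < G ∧ ∀ ε : ℝ, ε ^ 2 = 1 →
    (1 - alpha Kx Ky * (Real.cos θ + I * (ε * Real.sin θ))) *
      (1 - beta Kx Ky * (Real.cos θ - I * (ε * Real.sin θ))) =
      G * (dn (modulus Kx Ky) u +
        I * (ε * (modulus Kx Ky * sn (modulus Kx Ky) u * cn (modulus Kx Ky) u : ℝ))) ^ 2 := by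
  have h := etaValues hKx hKy
  have hc := cn_sq (modulus Kx Ky) u
  have hd := dn_sq (modulus_sq_lt_one hKx hKy) u
  obtain ⟨h1, h2⟩ := (zMap_eq_exp_iff hKx hKy u θ).1 hz
  have hW := h.normSq_pos hc hd
  have hre := h.symbol_re hc hd
  have him := h.symbol_im (s := sn (modulus Kx Ky) u) (c := cn (modulus Kx Ky) u)
    (d := dn (modulus Kx Ky) u)
  rw [halfAbs_sq hKx hKy, halfRe, halfIm, neg_sq, neg_sq] at h1 h2
  rw [← h1] at hre
  have hcs := Real.sin_sq_add_cos_sq θ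
  have hGpos : 0 < 2 * (sn (√(1 - modulus Kx Ky ^ 2)) (eta Kx Ky) *
      cn (√(1 - modulus Kx Ky ^ 2)) (eta Kx Ky)) ^ 2 *
      (1 + dn (√(1 - modulus Kx Ky ^ 2)) (2 * eta Kx Ky)) /
      (1 - sn (√(1 - modulus Kx Ky ^ 2)) (2 * eta Kx Ky)) := by
    have a1 := pow_two_pos_of_ne_zero (mul_ne_zero h.s₁_neg.ne h.c₁_pos.ne')
    have a2 := h.d₂_pos
    have a3 : 0 < 1 - sn (√(1 - modulus Kx Ky ^ 2)) (2 * eta Kx Ky) := by linarith [h.s₂_neg]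
    positivity
  generalize 2 * (sn (√(1 - modulus Kx Ky ^ 2)) (eta Kx Ky) *
      cn (√(1 - modulus Kx Ky ^ 2)) (eta Kx Ky)) ^ 2 *
      (1 + dn (√(1 - modulus Kx Ky ^ 2)) (2 * eta Kx Ky)) /
      (1 - sn (√(1 - modulus Kx Ky ^ 2)) (2 * eta Kx Ky)) = G at *
  generalize (sn (modulus Kx Ky) u * dn (√(1 - modulus Kx Ky ^ 2)) (eta Kx Ky)) ^ 2 +
    (cn (modulus Kx Ky) u * dn (modulus Kx Ky) u * sn (√(1 - modulus Kx Ky ^ 2)) (eta Kx Ky) *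
      cn (√(1 - modulus Kx Ky ^ 2)) (eta Kx Ky)) ^ 2 = W at *
  generalize modulus Kx Ky * sn (modulus Kx Ky) u * cn (modulus Kx Ky) u = q at *
  generalize dn (modulus Kx Ky) u = d at *
  generalize alpha Kx Ky = α at *
  generalize beta Kx Ky = β at *
  have him' : -(α - β) * (Real.sin θ * W) = 2 * G * (d * q) := by
    linear_combination 2 * him - (α - β) * h2
  clear him h2 h1 hc hd hz h
  generalize Real.sin θ = S at *
  generalize Real.cos θ = C at *
  refine ⟨G / W, div_pos hGpos hW, fun ε hε => ?_⟩
  have hW' : (W : ℂ) ≠ 0 := Complex.ofReal_ne_zero.2 hW.ne'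
  have hre' : (1 + (α : ℂ) * β) * W - (α + β) * (C * W) = G * (d ^ 2 - q ^ 2) := by
    exact_mod_cast hre
  have him'' : -((α : ℂ) - β) * (S * W) = 2 * G * (d * q) := by exact_mod_cast him'
  have hcs' : (S : ℂ) ^ 2 + (C : ℂ) ^ 2 = 1 := by exact_mod_cast hcs
  have hε' : (ε : ℂ) ^ 2 = 1 := by exact_mod_cast hε
  rw [Complex.ofReal_div, div_mul_eq_mul_div, eq_div_iff hW']
  linear_combination hre' + I * ε * him'' + (α : ℂ) * β * W * hcs' +
    ((α : ℂ) * β * S ^ 2 * W * (-1) * I ^ 2 - G * q ^ 2 * I ^ 2) * hε' +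
    (-(α : ℂ) * β * S ^ 2 * W - G * q ^ 2) * I_sq

/-- The radicand is `((p + iq)/(p - iq))² = (p + iq)⁴` for the unit vector `p + iq`. Its root with
positive real part is `(p + iq)²`, because `p² - q² > 0`. -/
theorem b_eq {u θ : ℝ} (hz : zMap Kx Ky u = Complex.exp (I * θ)) :
    b Kx Ky θ = (rootRe (modulus Kx Ky) u + I * rootIm (modulus Kx Ky) u) ^ 2 := by
  have hk := modulus_sq_lt_one hKx hKy
  have hE := rootNorm_pos hk u
  have e1 : Complex.exp (I * θ) = Real.cos θ + I * ((1 : ℝ) * Real.sin θ) := by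
    rw [mul_comm I (θ : ℂ), Complex.exp_mul_I]; push_cast; ring
  have e2 : Complex.exp (-(I * θ)) = Real.cos θ - I * ((1 : ℝ) * Real.sin θ) := by
    rw [mul_comm I (θ : ℂ), ← neg_mul, Complex.exp_mul_I, Complex.cos_neg, Complex.sin_neg]
    push_cast; ring
  obtain ⟨G, hG, hv⟩ := symbol_mul hKx hKy hz
  have hv₁ := hv 1 (by norm_num)
  have hv₂ := hv (-1) (by norm_num)
  have hG' : (G : ℂ) ≠ 0 := Complex.ofReal_ne_zero.2 hG.ne'
  have hu := unit_mul_conj (rootRe_sq_add hk u)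
  have hpos : 0 < (((rootRe (modulus Kx Ky) u : ℂ) + I * rootIm (modulus Kx Ky) u) ^ 2).re := by
    have h1 := abs_rootIm_lt hk u
    have h2 := sq_lt_sq' (neg_lt_of_abs_lt h1) (lt_of_abs_lt h1)
    rw [sq]
    simp
    nlinarith
  rw [b, ← sqrt_sq_of_re_pos hpos, e1, e2]
  congr 1
  have hn₁ : (1 - beta Kx Ky * (Real.cos θ + I * ((1 : ℝ) * Real.sin θ))) *
      (1 - alpha Kx Ky * (Real.cos θ - I * ((1 : ℝ) * Real.sin θ))) =
      G * ((dn (modulus Kx Ky) u : ℂ) -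
        I * (modulus Kx Ky * sn (modulus Kx Ky) u * cn (modulus Kx Ky) u : ℝ)) ^ 2 := by
    push_cast at hv₂ ⊢
    linear_combination hv₂
  have hn₂ : G * (dn (modulus Kx Ky) u + I * ((1 : ℝ) *
      (modulus Kx Ky * sn (modulus Kx Ky) u * cn (modulus Kx Ky) u : ℝ))) ^ 2 =
      G * ((dn (modulus Kx Ky) u : ℂ) +
        I * (modulus Kx Ky * sn (modulus Kx Ky) u * cn (modulus Kx Ky) u : ℝ)) ^ 2 := by
    push_cast; ring
  rw [hv₁, hn₁, hn₂, mul_div_mul_left _ _ hG']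
  have hs : ((√(rootNorm (modulus Kx Ky) u) : ℝ) : ℂ) ≠ 0 :=
    Complex.ofReal_ne_zero.2 (Real.sqrt_pos.2 hE).ne'
  have f1 : (dn (modulus Kx Ky) u : ℂ) =
      √(rootNorm (modulus Kx Ky) u) * rootRe (modulus Kx Ky) u := by
    rw [rootRe, Complex.ofReal_div]; field_simp
  have f2 : ((modulus Kx Ky * sn (modulus Kx Ky) u * cn (modulus Kx Ky) u : ℝ) : ℂ) =
      √(rootNorm (modulus Kx Ky) u) * rootIm (modulus Kx Ky) u := by
    rw [rootIm, Complex.ofReal_div]; field_simp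
  rw [f1, f2]
  generalize ((√(rootNorm (modulus Kx Ky) u) : ℝ) : ℂ) = t at *
  generalize (rootRe (modulus Kx Ky) u : ℂ) = p at *
  generalize (rootIm (modulus Kx Ky) u : ℂ) = q at *
  have hne := right_ne_zero_of_mul (hu ▸ one_ne_zero : (p + I * q) * (p - I * q) ≠ 0)
  rw [show t * p - I * (t * q) = t * (p - I * q) by ring,
    show t * p + I * (t * q) = t * (p + I * q) by ring, div_eq_iff (pow_ne_zero 2 (mul_ne_zero hs hne))]
  linear_combination -t ^ 2 * (p + I * q) ^ 2 * ((p + I * q) * (p - I * q) + 1) * hu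

theorem re_b_pos {θ : ℝ} (hθ : θ ∈ Set.Ico (0 : ℝ) (2 * π)) : 0 < (b Kx Ky θ).re := by
  have hk := modulus_sq_lt_one hKx hKy
  rw [b_eq hKx hKy (isU_uu hKx hKy hθ).2.1]
  have h1 := abs_rootIm_lt hk (uu Kx Ky θ)
  have h2 := sq_lt_sq' (neg_lt_of_abs_lt h1) (lt_of_abs_lt h1)
  rw [sq]
  simp
  nlinarith

theorem sinh_gam_eq {u θ : ℝ} (hz : zMap Kx Ky u = Complex.exp (I * θ)) :
    Real.sinh (gam Kx Ky θ) =
      cn (√(1 - modulus Kx Ky ^ 2)) (2 * eta Kx Ky) *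
        (1 - (1 - modulus Kx Ky ^ 2) * sn (√(1 - modulus Kx Ky ^ 2)) (eta Kx Ky) ^ 4) /
        (2 * modulus Kx Ky) * (√(rootNorm (modulus Kx Ky) u) / halfAbs Kx Ky u) ^ 2 := by
  have hk := modulus_sq_lt_one hKx hKy
  rw [gam_eq_log hKx hKy hz, lamRatio, (etaValues hKx hKy).sinh_log_ratio (cn_sq _ u) (dn_sq hk u),
    div_pow, Real.sq_sqrt (rootNorm_pos hk u).le, halfAbs_sq hKx hKy, halfRe, halfIm, neg_sq, neg_sq,
    rootNorm]

theorem sinh_gam_pos {u θ : ℝ} (hz : zMap Kx Ky u = Complex.exp (I * θ)) :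
    0 < Real.sinh (gam Kx Ky θ) := by
  have h := etaValues hKx hKy
  have h1 := h.c₂_pos
  have h2 := h.denom_pos
  have h3 := h.k_pos
  have h4 := Real.sqrt_pos.2 (rootNorm_pos (modulus_sq_lt_one hKx hKy) u)
  have h5 := halfAbs_pos hKx hKy u
  rw [sinh_gam_eq hKx hKy hz]
  positivity

/-- Both factors are the same positive constant times a square, so the root of the product is
rational in the lengths `√(rootNorm)` and `halfAbs`. These are the normalizations of the unit
vectors and half-vectors in the kernels, where they cancel. -/
theorem sqrt_sinh_mul_sinh {u v θ θ' : ℝ} (hu : zMap Kx Ky u = Complex.exp (I * θ))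
    (hv : zMap Kx Ky v = Complex.exp (I * θ')) :
    √(Real.sinh (gam Kx Ky θ) * Real.sinh (gam Kx Ky θ')) =
      cn (√(1 - modulus Kx Ky ^ 2)) (2 * eta Kx Ky) *
        (1 - (1 - modulus Kx Ky ^ 2) * sn (√(1 - modulus Kx Ky ^ 2)) (eta Kx Ky) ^ 4) /
        (2 * modulus Kx Ky) * (√(rootNorm (modulus Kx Ky) u) / halfAbs Kx Ky u) *
        (√(rootNorm (modulus Kx Ky) v) / halfAbs Kx Ky v) := by
  have h := etaValues hKx hKy
  have h1 := h.c₂_pos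
  have h2 := h.denom_pos
  have h3 := h.k_pos
  have h4 := Real.sqrt_pos.2 (rootNorm_pos (modulus_sq_lt_one hKx hKy) u)
  have h5 := halfAbs_pos hKx hKy u
  have h6 := Real.sqrt_pos.2 (rootNorm_pos (modulus_sq_lt_one hKx hKy) v)
  have h7 := halfAbs_pos hKx hKy v
  rw [sinh_gam_eq hKx hKy hu, sinh_gam_eq hKx hKy hv]
  refine (Real.sqrt_eq_iff_mul_self_eq_of_pos (by positivity)).2 ?_
  ring

end Kernels

/-- A form of the addition theorem for `cn` without denominators. -/
theorem cn_sub_mul {k : ℝ} (hk : k ^ 2 < 1) (u v : ℝ) :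
    cn k (u - v) * (sn k u * cn k v * dn k v + sn k v * cn k u * dn k u) =
      sn k u * cn k u * dn k v + sn k v * cn k v * dn k u := by
  have hp := (addition_denom_pos hk u v).ne'
  have hc := cn_sq k u
  have hd := dn_sq hk u
  have hc' := cn_sq k v
  have hd' := dn_sq hk v
  rw [cn_sub hk, div_mul_eq_mul_div, div_eq_iff hp]
  generalize sn k u = s at *
  generalize cn k u = c at *
  generalize dn k u = d at *
  generalize sn k v = s' at *
  generalize cn k v = c' at *
  generalize dn k v = d' at *
  linear_combination (s * c * d') * hc' + s' * c' * d * hc + s ^ 2 * s' * c' * d * hd' +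
    s * s' ^ 2 * c * d' * hd

section Kernels

variable {Kx Ky : ℝ} (hKx : 0 < Kx) (hKy : dual Kx < Ky)
include hKx hKy

theorem sinh_dual_eq : Real.sinh (2 * dual Kx) = modulus Kx Ky * Real.sinh (2 * Ky) := by
  have h1 : 0 < Real.sinh (2 * Ky) := Real.sinh_pos_iff.2 (by linarith [dual_pos hKx])
  rw [modulus, div_mul_cancel₀ _ h1.ne']

/-- The sum of roots is `2(pp' + qq')`, proportional to the numerator of `dn(u - v)`. The half-angle
sine is proportional to that of `sn(u - v)`. The addition denominators cancel, and `s₂_mul` matches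
the constants. -/
theorem sum_kernel {θ θ' : ℝ} (hθ : θ ∈ Set.Ico (0 : ℝ) (2 * π))
    (hθ' : θ' ∈ Set.Ico (0 : ℝ) (2 * π)) :
    1 / (2 * Real.sin ((θ - θ') / 2)) *
          (Complex.sqrt (b Kx Ky θ / b Kx Ky θ') + Complex.sqrt (b Kx Ky θ' / b Kx Ky θ)) =
        Real.sinh (2 * Ky) / Real.sqrt (Real.sinh (gam Kx Ky θ) * Real.sinh (gam Kx Ky θ')) *
          (dn (modulus Kx Ky) (uu Kx Ky θ - uu Kx Ky θ') /
            sn (modulus Kx Ky) (uu Kx Ky θ - uu Kx Ky θ')) := by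
  have h := etaValues hKx hKy
  have hk := modulus_sq_lt_one hKx hKy
  have hu := isU_uu hKx hKy hθ
  have hv := isU_uu hKx hKy hθ'
  generalize uu Kx Ky θ = u at *
  generalize uu Kx Ky θ' = v at *
  rw [b_eq hKx hKy hu.2.1, b_eq hKx hKy hv.2.1, sqrt_div_add_sqrt_div (rootRe_sq_add hk u)
    (rootRe_sq_add hk v) (abs_rootIm_lt hk u) (abs_rootIm_lt hk v)]
  obtain ⟨hX, hY⟩ := half_eq hKx hKy hθ hu.1 hu.2.1
  obtain ⟨hX', hY'⟩ := half_eq hKx hKy hθ' hv.1 hv.2.1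
  have hR := halfAbs_pos hKx hKy u
  have hR' := halfAbs_pos hKx hKy v
  have hsin : Real.sin ((θ - θ') / 2) = -(sn (√(1 - modulus Kx Ky ^ 2)) (eta Kx Ky) *
      cn (√(1 - modulus Kx Ky ^ 2)) (eta Kx Ky) * dn (√(1 - modulus Kx Ky ^ 2)) (eta Kx Ky)) *
      (sn (modulus Kx Ky) u * cn (modulus Kx Ky) v * dn (modulus Kx Ky) v -
        sn (modulus Kx Ky) v * cn (modulus Kx Ky) u * dn (modulus Kx Ky) u) /
      (halfAbs Kx Ky u * halfAbs Kx Ky v) := by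
    rw [eq_div_iff (mul_pos hR hR').ne', sub_div, Real.sin_sub]
    trans halfIm Kx Ky u * halfRe Kx Ky v - halfRe Kx Ky u * halfIm Kx Ky v
    · rw [hX, hY, hX', hY']; ring
    · simp only [halfRe, halfIm]; ring
  norm_cast
  rw [hsin, sqrt_sinh_mul_sinh hKx hKy hu.2.1 hv.2.1, h.sinh_Ky, dn_sub hk, sn_sub hk,
    div_div_div_cancel_right₀ (addition_denom_pos hk u v).ne', rootRe, rootRe, rootIm, rootIm]
  have hE := Real.sqrt_pos.2 (rootNorm_pos hk u)
  have hE' := Real.sqrt_pos.2 (rootNorm_pos hk v)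
  have hs2 := h.s₂_mul
  have hD := h.denom_pos.ne'
  have g1 := h.s₂_neg.ne
  have g2 := h.c₂_pos.ne'
  have g3 := h.k_pos.ne'
  have g4 := h.s₁_neg.ne
  have g5 := h.c₁_pos.ne'
  have g6 := h.d₁_pos.ne'
  -- When this numerator vanishes, both sides are `0` because division by zero gives zero.
  by_cases hN : sn (modulus Kx Ky) u * cn (modulus Kx Ky) v * dn (modulus Kx Ky) v -
        sn (modulus Kx Ky) v * cn (modulus Kx Ky) u * dn (modulus Kx Ky) u = 0
  · simp [hN]
  generalize sn (modulus Kx Ky) u * cn (modulus Kx Ky) v * dn (modulus Kx Ky) v -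
        sn (modulus Kx Ky) v * cn (modulus Kx Ky) u * dn (modulus Kx Ky) u = n at *
  generalize 1 - (1 - modulus Kx Ky ^ 2) * sn (√(1 - modulus Kx Ky ^ 2)) (eta Kx Ky) ^ 4 = Δ at *
  field_simp
  linear_combination -(dn (modulus Kx Ky) u * dn (modulus Kx Ky) v + modulus Kx Ky ^ 2 *
    sn (modulus Kx Ky) u * cn (modulus Kx Ky) u * sn (modulus Kx Ky) v * cn (modulus Kx Ky) v) * hs2

/-- The difference of roots is `2i(pq' + qp')`, and the sine is proportional to `s c' d' + s' c d`.
Their quotient is a multiple of `cn(u - v)` by `cn_sub_mul`. The conditions on `θ + θ'` keep the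
sine nonzero, which is needed since `cn(u - v)` need not vanish. -/
theorem difference_kernel {θ θ' : ℝ} (hθ : θ ∈ Set.Ico (0 : ℝ) (2 * π))
    (hθ' : θ' ∈ Set.Ico (0 : ℝ) (2 * π)) (h₀ : θ + θ' ≠ 0) (h₁ : θ + θ' ≠ 2 * π) :
    1 / (2 * Real.sin ((θ + θ') / 2)) *
          (Complex.sqrt (b Kx Ky θ * b Kx Ky θ') - 1 / Complex.sqrt (b Kx Ky θ * b Kx Ky θ')) =
        -Complex.I * Real.sinh (2 * dual Kx) /
          Real.sqrt (Real.sinh (gam Kx Ky θ) * Real.sinh (gam Kx Ky θ')) *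
          cn (modulus Kx Ky) (uu Kx Ky θ - uu Kx Ky θ') := by
  have h := etaValues hKx hKy
  have hk := modulus_sq_lt_one hKx hKy
  have hu := isU_uu hKx hKy hθ
  have hv := isU_uu hKx hKy hθ'
  generalize uu Kx Ky θ = u at *
  generalize uu Kx Ky θ' = v at *
  rw [b_eq hKx hKy hu.2.1, b_eq hKx hKy hv.2.1, sqrt_mul_sub_inv (rootRe_sq_add hk u)
    (rootRe_sq_add hk v) (abs_rootIm_lt hk u) (abs_rootIm_lt hk v)]
  obtain ⟨hX, hY⟩ := half_eq hKx hKy hθ hu.1 hu.2.1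
  obtain ⟨hX', hY'⟩ := half_eq hKx hKy hθ' hv.1 hv.2.1
  have hR := halfAbs_pos hKx hKy u
  have hR' := halfAbs_pos hKx hKy v
  have hsin : Real.sin ((θ + θ') / 2) = (sn (√(1 - modulus Kx Ky ^ 2)) (eta Kx Ky) *
      cn (√(1 - modulus Kx Ky ^ 2)) (eta Kx Ky) * dn (√(1 - modulus Kx Ky ^ 2)) (eta Kx Ky)) *
      (sn (modulus Kx Ky) u * cn (modulus Kx Ky) v * dn (modulus Kx Ky) v +
        sn (modulus Kx Ky) v * cn (modulus Kx Ky) u * dn (modulus Kx Ky) u) /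
      (halfAbs Kx Ky u * halfAbs Kx Ky v) := by
    rw [eq_div_iff (mul_pos hR hR').ne', add_div, Real.sin_add]
    trans halfIm Kx Ky u * halfRe Kx Ky v + halfRe Kx Ky u * halfIm Kx Ky v
    · rw [hX, hY, hX', hY']; ring
    · simp only [halfRe, halfIm]; ring
  have hsin0 : Real.sin ((θ + θ') / 2) ≠ 0 := by
    have hpos : 0 < θ + θ' := lt_of_le_of_ne (add_nonneg hθ.1 hθ'.1) (Ne.symm h₀)
    rcases lt_or_gt_of_ne h₁ with hlt | hgt
    · exact (Real.sin_pos_of_pos_of_lt_pi (by linarith) (by linarith)).ne'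
    · rw [← neg_ne_zero, ← Real.sin_sub_pi]
      exact (Real.sin_pos_of_pos_of_lt_pi (by linarith) (by linarith [hθ.2, hθ'.2])).ne'
  have hcn := cn_sub_mul hk u v
  have key : 1 / (2 * Real.sin ((θ + θ') / 2)) *
      (2 * (rootRe (modulus Kx Ky) u * rootIm (modulus Kx Ky) v +
        rootIm (modulus Kx Ky) u * rootRe (modulus Kx Ky) v)) =
      -Real.sinh (2 * dual Kx) /
          Real.sqrt (Real.sinh (gam Kx Ky θ) * Real.sinh (gam Kx Ky θ')) *
          cn (modulus Kx Ky) (u - v) := by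
    rw [hsin] at hsin0
    rw [hsin, sqrt_sinh_mul_sinh hKx hKy hu.2.1 hv.2.1, sinh_dual_eq hKx hKy, h.sinh_Ky,
      rootRe, rootRe, rootIm, rootIm]
    have hE := Real.sqrt_pos.2 (rootNorm_pos hk u)
    have hE' := Real.sqrt_pos.2 (rootNorm_pos hk v)
    have hs2 := h.s₂_mul
    have hD := h.denom_pos.ne'
    have g1 := h.s₂_neg.ne
    have g2 := h.c₂_pos.ne'
    have g3 := h.k_pos.ne'
    have g4 := h.s₁_neg.ne
    have g5 := h.c₁_pos.ne'
    have g6 := h.d₁_pos.ne'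
    have hN := right_ne_zero_of_mul (div_ne_zero_iff.1 hsin0).1
    clear hsin0 hsin
    rw [← eq_div_iff hN] at hcn
    rw [hcn]
    generalize sn (modulus Kx Ky) u * cn (modulus Kx Ky) v * dn (modulus Kx Ky) v +
        sn (modulus Kx Ky) v * cn (modulus Kx Ky) u * dn (modulus Kx Ky) u = n at *
    generalize 1 - (1 - modulus Kx Ky ^ 2) * sn (√(1 - modulus Kx Ky ^ 2)) (eta Kx Ky) ^ 4 = Δ at *
    field_simp
    linear_combination (dn (modulus Kx Ky) u * sn (modulus Kx Ky) v * cn (modulus Kx Ky) v +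
      dn (modulus Kx Ky) v * sn (modulus Kx Ky) u * cn (modulus Kx Ky) u) * hs2
  have key' := congrArg (fun x : ℝ => I * (x : ℂ)) key
  push_cast at key' ⊢
  linear_combination key'

end Kernels

/-! ### Invertibility by positivity; the Fourier transition matrix -/

/-- If `W` is a nonzero multiple of a unitary matrix and `x`, `y` have entries with positive real
part, then `diag(x) W + W diag(y)` is invertible. -/
theorem isUnit_diagonal_mul_add_mul_diagonal {n : Type*} [Fintype n] [DecidableEq n]
    {W : Matrix n n ℂ} {c : ℝ} (hc : 0 < c) (hW : Wᴴ * W = (c : ℂ) • (1 : Matrix n n ℂ))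
    {x y : n → ℂ} (hx : ∀ i, 0 < (x i).re) (hy : ∀ i, 0 < (y i).re) :
    IsUnit (diagonal x * W + W * diagonal y) := by
  rw [← Matrix.mulVec_injective_iff_isUnit, ← Matrix.coe_mulVecLin, ← LinearMap.ker_eq_bot,
    LinearMap.ker_eq_bot']
  intro v hv
  rw [Matrix.mulVecLin_apply, Matrix.add_mulVec, ← Matrix.mulVec_mulVec, ← Matrix.mulVec_mulVec] at hv
  -- Pair the kernel equation with `W v`. The two terms become sums of `x_i` and of `c y_i` with
  -- nonnegative weights, so the real part of the total can vanish only for `v = 0`.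
  have h1 : star (W *ᵥ v) ⬝ᵥ (diagonal x *ᵥ (W *ᵥ v)) =
      ∑ i, x i * (‖(W *ᵥ v) i‖ ^ 2 : ℝ) := by
    simp only [dotProduct, Matrix.mulVec_diagonal, Pi.star_apply]
    refine Finset.sum_congr rfl fun i _ => ?_
    rw [Complex.ofReal_pow, ← Complex.conj_mul', Complex.star_def]
    ring
  have h2 : star (W *ᵥ v) ⬝ᵥ (W *ᵥ (diagonal y *ᵥ v)) = c * ∑ i, y i * (‖v i‖ ^ 2 : ℝ) := by
    rw [Matrix.star_mulVec, ← Matrix.dotProduct_mulVec, Matrix.mulVec_mulVec, hW,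
      Matrix.smul_mulVec, Matrix.one_mulVec, dotProduct_smul, smul_eq_mul]
    congr 1
    simp only [dotProduct, Matrix.mulVec_diagonal, Pi.star_apply]
    refine Finset.sum_congr rfl fun i _ => ?_
    rw [Complex.ofReal_pow, ← Complex.conj_mul', Complex.star_def]
    ring
  have h3 := congrArg (fun w => (star (W *ᵥ v) ⬝ᵥ w).re) hv
  simp only [dotProduct_add, h1, h2, dotProduct_zero, Complex.add_re, Complex.re_ofReal_mul,
    Complex.re_sum, Complex.re_mul_ofReal, Complex.zero_re] at h3
  have h4 : 0 ≤ ∑ i, (x i).re * ‖(W *ᵥ v) i‖ ^ 2 :=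
    Finset.sum_nonneg fun i _ => mul_nonneg (hx i).le (sq_nonneg _)
  have h5 : ∀ i ∈ Finset.univ, 0 ≤ (y i).re * ‖v i‖ ^ 2 :=
    fun i _ => mul_nonneg (hy i).le (sq_nonneg _)
  have h6 : ∑ i, (y i).re * ‖v i‖ ^ 2 = 0 := by
    have := Finset.sum_nonneg h5
    nlinarith
  funext i
  have h7 := (Finset.sum_eq_zero_iff_of_nonneg h5).1 h6 i (Finset.mem_univ i)
  simpa [(hy i).ne'] using h7

/-- The Fourier matrix of order `N`. -/
def fourierMat (N : ℕ) : Matrix (Fin N) (Fin N) ℂ :=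
  Matrix.of fun n j => Complex.exp (2 * π * I / N) ^ ((n : ℕ) * (j : ℕ))

theorem fourierMat_mul_conjTranspose {N : ℕ} (hN : 0 < N) :
    fourierMat N * (fourierMat N)ᴴ = (N : ℂ) • (1 : Matrix (Fin N) (Fin N) ℂ) := by
  have hζ := Complex.isPrimitiveRoot_exp N hN.ne'
  set ζ := Complex.exp (2 * π * I / N) with hζdef
  have hstar : ζ * star ζ = 1 := by
    rw [Complex.star_def, Complex.mul_conj', hζ.norm'_eq_one hN.ne']
    simp
  ext n m
  have e : (fourierMat N * (fourierMat N)ᴴ) n m =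
      ∑ j ∈ Finset.range N, (ζ ^ (n : ℕ) * star ζ ^ (m : ℕ)) ^ j := by
    rw [Matrix.mul_apply, ← Fin.sum_univ_eq_sum_range]
    refine Finset.sum_congr rfl fun j _ => ?_
    simp [fourierMat, mul_pow, pow_mul, ← hζdef]
  rw [e, Matrix.smul_apply, Matrix.one_apply, smul_eq_mul]
  split_ifs with h
  · rw [h, ← mul_pow, hstar]; simp
  · have hw : ζ ^ (n : ℕ) * star ζ ^ (m : ℕ) ≠ 1 := by
      intro h1
      refine h (Fin.ext (hζ.pow_inj n.2 m.2 ?_))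
      calc ζ ^ (n : ℕ) = ζ ^ (n : ℕ) * star ζ ^ (m : ℕ) * ζ ^ (m : ℕ) := by
            rw [mul_assoc, ← mul_pow, mul_comm (star ζ), hstar, one_pow, mul_one]
        _ = ζ ^ (m : ℕ) := by rw [h1, one_mul]
    have hwN : (ζ ^ (n : ℕ) * star ζ ^ (m : ℕ)) ^ N = 1 := by
      rw [mul_pow, ← pow_mul, ← pow_mul, mul_comm (n : ℕ), mul_comm (m : ℕ), pow_mul, pow_mul,
        ← star_pow, hζ.pow_eq_one]
      simp
    rw [geom_sum_eq hw, hwN]; simp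

theorem fourierMat_conjTranspose_mul {N : ℕ} (hN : 0 < N) :
    (fourierMat N)ᴴ * fourierMat N = (N : ℂ) • (1 : Matrix (Fin N) (Fin N) ℂ) := by
  have hN' : (N : ℂ) ≠ 0 := by exact_mod_cast hN.ne'
  have h := fourierMat_mul_conjTranspose hN
  have h1 : fourierMat N * ((N : ℂ)⁻¹ • (fourierMat N)ᴴ) = 1 := by
    rw [Matrix.mul_smul, h, smul_smul, inv_mul_cancel₀ hN', one_smul]
  have h2 := mul_eq_one_comm.1 h1
  rw [Matrix.smul_mul] at h2
  rw [← h2, smul_smul, mul_inv_cancel₀ hN', one_smul]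

/-- The transition matrix between periodic and antiperiodic plane waves. -/
def transitionMat (N : ℕ) : Matrix (Fin N) (Fin N) ℂ :=
  (fourierMat N)ᴴ * diagonal (fun n : Fin N => Complex.exp (π * I / N) ^ (n : ℕ)) * fourierMat N

theorem norm_exp_pi_div (N : ℕ) : ‖Complex.exp (π * I / N)‖ = 1 := by
  rw [show (π * I / N : ℂ) = ((π / N : ℝ) : ℂ) * I by push_cast; ring, Complex.norm_exp_ofReal_mul_I]

theorem transitionMat_conjTranspose_mul {N : ℕ} (hN : 0 < N) :
    (transitionMat N)ᴴ * transitionMat N =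
      (((N : ℝ) ^ 2 : ℝ) : ℂ) • (1 : Matrix (Fin N) (Fin N) ℂ) := by
  have hd : (diagonal (fun n : Fin N => Complex.exp (π * I / N) ^ (n : ℕ)))ᴴ *
      diagonal (fun n : Fin N => Complex.exp (π * I / N) ^ (n : ℕ)) = 1 := by
    rw [Matrix.diagonal_conjTranspose, Matrix.diagonal_mul_diagonal, ← Matrix.diagonal_one]
    congr 1
    funext n
    rw [Pi.star_apply, star_pow, ← mul_pow, Complex.star_def, Complex.conj_mul', norm_exp_pi_div]
    simp
  rw [transitionMat]
  generalize diagonal (fun n : Fin N => Complex.exp (π * I / N) ^ (n : ℕ)) = E at *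
  calc _ = (fourierMat N)ᴴ * (Eᴴ * (fourierMat N * (fourierMat N)ᴴ) * E) * fourierMat N := by
        simp only [Matrix.conjTranspose_mul, Matrix.conjTranspose_conjTranspose, Matrix.mul_assoc]
    _ = _ := by
        rw [fourierMat_mul_conjTranspose hN, Matrix.mul_smul, Matrix.mul_one, Matrix.smul_mul, hd,
          Matrix.mul_smul, Matrix.mul_one, Matrix.smul_mul, fourierMat_conjTranspose_mul hN, smul_smul]
        push_cast
        rw [sq]

theorem transitionMat_apply {N : ℕ} (hN : 0 < N) (i j : Fin N) :
    transitionMat N i j =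
      ∑ n ∈ Finset.range N, Complex.exp (I * (thetaA N j - thetaP N i : ℝ)) ^ n := by
  rw [transitionMat, Matrix.mul_apply, ← Fin.sum_univ_eq_sum_range]
  refine Finset.sum_congr rfl fun n _ => ?_
  have hN' : (N : ℂ) ≠ 0 := by exact_mod_cast hN.ne'
  simp only [Matrix.mul_diagonal, Matrix.conjTranspose_apply, fourierMat, Matrix.of_apply,
    Complex.star_def, ← Complex.exp_conj, ← Complex.exp_nat_mul, ← Complex.exp_add]
  congr 1
  simp only [map_mul, map_div₀, map_natCast, map_ofNat, Complex.conj_I, Complex.conj_ofReal,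
    thetaA, thetaP]
  push_cast
  field_simp
  ring

/-- The difference of an antiperiodic and a periodic quasimomentum is an odd multiple of `π/N`. -/
theorem exp_theta_sub_pow {N : ℕ} (hN : 0 < N) (i j : Fin N) :
    Complex.exp (I * (thetaA N j - thetaP N i : ℝ)) ^ N = -1 := by
  have hN' : (N : ℂ) ≠ 0 := by exact_mod_cast hN.ne'
  have e : (N : ℂ) * (I * (thetaA N j - thetaP N i : ℝ)) =
      π * I + ((j : ℤ) - (i : ℤ) : ℤ) * (2 * π * I) := by
    simp [thetaA, thetaP]
    field_simp
    ring
  rw [← Complex.exp_nat_mul, e, Complex.exp_add, Complex.exp_int_mul_two_pi_mul_I,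
    Complex.exp_pi_mul_I, mul_one]

/-- Since `e^{iNx} = -1`, the geometric sum of `e^{inx}` is `-2/(e^{ix} - 1)`. That is `1/sin(x/2)`
up to the factor `-i e^{ix/2}`, which splits into row and column phases. -/
theorem inv_sin_eq {N : ℕ} (hN : 0 < N) (i j : Fin N) :
    (Real.sin ((thetaA N j - thetaP N i) / 2) : ℂ)⁻¹ =
      -I * Complex.exp (I * (thetaA N j - thetaP N i) / 2) * transitionMat N i j := by
  have hz := exp_theta_sub_pow hN i j
  rw [transitionMat_apply hN]
  have hz1 : Complex.exp (I * (thetaA N j - thetaP N i : ℝ)) ≠ 1 := by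
    intro h
    rw [h, one_pow] at hz
    norm_num at hz
  rw [geom_sum_eq hz1, hz, ← Complex.ofReal_sub]
  generalize thetaA N j - thetaP N i = x at *
  have e1 : Complex.exp (I * x) = Complex.exp (I * x / 2) ^ 2 := by
    rw [← Complex.exp_nat_mul]; congr 1; push_cast; ring
  have e2 : (Real.sin (x / 2) : ℂ) = (Complex.exp (I * x / 2) ^ 2 - 1) * (-I) /
      (2 * Complex.exp (I * x / 2)) := by
    rw [Complex.ofReal_sin, Complex.sin, show -((x / 2 : ℝ) : ℂ) * I = -(I * x / 2) by push_cast; ring,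
      show ((x / 2 : ℝ) : ℂ) * I = I * x / 2 by push_cast; ring, Complex.exp_neg]
    have := Complex.exp_ne_zero (I * x / 2)
    field_simp
    ring
  rw [e2, e1]
  rw [e1] at hz1
  have h2 := sub_ne_zero.2 hz1
  have h3 := Complex.exp_ne_zero (I * x / 2)
  field_simp
  linear_combination -2 * I_sq

/-! ### Quasimomenta and the diagonal matrices -/

theorem thetaP_mem {N : ℕ} (hN : 0 < N) (j : Fin N) : thetaP N j ∈ Set.Ico (0 : ℝ) (2 * π) := by
  have hN' : (0 : ℝ) < N := by exact_mod_cast hN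
  have hj : ((j : ℕ) : ℝ) < N := by exact_mod_cast j.2
  have hpi := Real.pi_pos
  refine ⟨by unfold thetaP; positivity, ?_⟩
  rw [thetaP, div_lt_iff₀ hN']
  nlinarith

theorem thetaA_pos {N : ℕ} (hN : 0 < N) (j : Fin N) : 0 < thetaA N j := by
  have hN' : (0 : ℝ) < N := by exact_mod_cast hN
  unfold thetaA
  positivity

theorem thetaA_mem {N : ℕ} (hN : 0 < N) (j : Fin N) : thetaA N j ∈ Set.Ico (0 : ℝ) (2 * π) := by
  have hN' : (0 : ℝ) < N := by exact_mod_cast hN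
  have hj : ((j : ℕ) : ℝ) + 1 ≤ N := by exact_mod_cast j.2
  have hpi := Real.pi_pos
  refine ⟨(thetaA_pos hN j).le, ?_⟩
  rw [thetaA, div_lt_iff₀ hN']
  nlinarith

theorem thetaP_add_thetaA_ne {N : ℕ} (hN : 0 < N) (i j : Fin N) :
    thetaP N i + thetaA N j ≠ 2 * π := by
  have hN' : (N : ℝ) ≠ 0 := by exact_mod_cast hN.ne'
  have hpi := Real.pi_ne_zero
  intro h
  rw [thetaP, thetaA, ← add_div, div_eq_iff hN'] at h
  have h1 : 2 * ((i : ℕ) : ℝ) + 2 * ((j : ℕ) : ℝ) + 1 = 2 * N :=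
    mul_left_cancel₀ hpi (by linear_combination h)
  have h2 : 2 * (i : ℕ) + 2 * (j : ℕ) + 1 = 2 * N := by exact_mod_cast h1
  omega

theorem conjMat_mul {l m n : Type*} [Fintype m] (M : Matrix l m ℂ) (M' : Matrix m n ℂ) :
    conjMat (M * M') = conjMat M * conjMat M' :=
  Matrix.map_mul

theorem conjMat_conjMat {m n : Type*} (M : Matrix m n ℂ) : conjMat (conjMat M) = M := by
  ext i j; simp [conjMat]

theorem conjMat_matLam (Kx Ky : ℝ) (l : ℤ) {N : ℕ} (θ : Fin N → ℝ) :
    conjMat (matLam Kx Ky l θ) = diagonal fun j =>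
      Complex.exp (-(I * ((l - 1 / 2) * θ j))) / (√(Real.sinh (gam Kx Ky (θ j))) : ℝ) := by
  rw [conjMat, matLam, Matrix.diagonal_map (map_zero _)]
  congr 1
  funext j
  simp only [map_div₀, Complex.conj_ofReal, ← Complex.exp_conj, map_mul, map_sub,
    map_one, Complex.conj_I, map_ofNat, map_intCast, neg_mul]

theorem norm_exp_phase (l : ℤ) (x : ℝ) : ‖Complex.exp (I * ((l - 1 / 2) * x))‖ = 1 := by
  rw [show (I * ((l - 1 / 2) * x) : ℂ) = ((((l : ℝ) - 1 / 2) * x : ℝ) : ℂ) * I by push_cast; ring,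
    Complex.norm_exp_ofReal_mul_I]

theorem norm_det_matLam {Kx Ky : ℝ} (l : ℤ) {N : ℕ} {θ : Fin N → ℝ}
    (hθ : ∀ j, 0 < Real.sinh (gam Kx Ky (θ j))) :
    ‖(matLam Kx Ky l θ).det‖ = (√(∏ j, Real.sinh (gam Kx Ky (θ j))))⁻¹ := by
  rw [matLam, Matrix.det_diagonal, norm_prod, Real.sqrt_prod _ fun j _ => (hθ j).le,
    ← Finset.prod_inv_distrib]
  refine Finset.prod_congr rfl fun j _ => ?_
  rw [norm_div, norm_exp_phase, one_div, Complex.norm_real, Real.norm_of_nonneg (Real.sqrt_nonneg _)]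

theorem det_conjMat {N : ℕ} (M : Matrix (Fin N) (Fin N) ℂ) :
    (conjMat M).det = starRingEnd ℂ M.det :=
  ((starRingEnd ℂ).map_det M).symm

theorem isUnit_det_matLam {Kx Ky : ℝ} (l : ℤ) {N : ℕ} {θ : Fin N → ℝ}
    (hθ : ∀ j, 0 < Real.sinh (gam Kx Ky (θ j))) : IsUnit (matLam Kx Ky l θ).det := by
  rw [isUnit_iff_ne_zero, ← norm_ne_zero_iff, norm_det_matLam l hθ]
  exact inv_ne_zero (Real.sqrt_pos.2 (Finset.prod_pos fun j _ => hθ j)).ne'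

/-! ### Invertibility of `D` and factorizations through `Φ` and `Ψ` -/

section Matrices

variable {Kx Ky : ℝ} (hKx : 0 < Kx) (hKy : dual Kx < Ky)
include hKx hKy

theorem sinh_gam_pos_of_mem {θ : ℝ} (hθ : θ ∈ Set.Ico (0 : ℝ) (2 * π)) :
    0 < Real.sinh (gam Kx Ky θ) :=
  sinh_gam_pos hKx hKy (isU_uu hKx hKy hθ).2.1

/-- `√b` as a function of the angle. -/
def rootB (Kx Ky θ : ℝ) : ℂ :=
  rootRe (modulus Kx Ky) (uu Kx Ky θ) + I * rootIm (modulus Kx Ky) (uu Kx Ky θ)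

theorem rootB_ne_zero (θ : ℝ) : rootB Kx Ky θ ≠ 0 :=
  left_ne_zero_of_mul (unit_mul_conj
    (rootRe_sq_add (modulus_sq_lt_one hKx hKy) (uu Kx Ky θ)) ▸ one_ne_zero :
      rootB Kx Ky θ * (rootRe (modulus Kx Ky) (uu Kx Ky θ) -
        I * rootIm (modulus Kx Ky) (uu Kx Ky θ)) ≠ 0)

theorem sqrt_b_div_add {θ θ' : ℝ} (hθ : θ ∈ Set.Ico (0 : ℝ) (2 * π))
    (hθ' : θ' ∈ Set.Ico (0 : ℝ) (2 * π)) :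
    Complex.sqrt (b Kx Ky θ' / b Kx Ky θ) + Complex.sqrt (b Kx Ky θ / b Kx Ky θ') =
      (b Kx Ky θ + b Kx Ky θ') / (rootB Kx Ky θ * rootB Kx Ky θ') := by
  have hk := modulus_sq_lt_one hKx hKy
  have h1 := rootB_ne_zero hKx hKy θ
  have h2 := rootB_ne_zero hKx hKy θ'
  have e1 := unit_mul_conj (rootRe_sq_add hk (uu Kx Ky θ))
  have e2 := unit_mul_conj (rootRe_sq_add hk (uu Kx Ky θ'))
  rw [b_eq hKx hKy (isU_uu hKx hKy hθ).2.1, b_eq hKx hKy (isU_uu hKx hKy hθ').2.1,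
    sqrt_div_of_unit (rootRe_sq_add hk _) (abs_rootIm_lt hk _) (abs_rootIm_lt hk _),
    sqrt_div_of_unit (rootRe_sq_add hk _) (abs_rootIm_lt hk _) (abs_rootIm_lt hk _),
    eq_div_iff (mul_ne_zero h1 h2)]
  unfold rootB
  linear_combination (rootRe (modulus Kx Ky) (uu Kx Ky θ') +
    I * rootIm (modulus Kx Ky) (uu Kx Ky θ')) ^ 2 * e1 + (rootRe (modulus Kx Ky) (uu Kx Ky θ) +
    I * rootIm (modulus Kx Ky) (uu Kx Ky θ) : ℂ) ^ 2 * e2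

variable {N : ℕ} (hN : 0 < N) (l : ℤ)
include hN

/-- By `√(b'/b) + √(b/b') = (b + b')/(√b √b')` and `inv_sin_eq`, removing diagonal factors from `D`
leaves `diag(b) W + W diag(b')`, with `W` the transition matrix. -/
theorem isUnit_matD : IsUnit (matD Kx Ky N l) := by
  have hN' : (N : ℂ) ≠ 0 := by exact_mod_cast hN.ne'
  have hNr : (0 : ℝ) < N := by exact_mod_cast hN
  have h := isUnit_diagonal_mul_add_mul_diagonal (pow_pos hNr 2) (transitionMat_conjTranspose_mul hN)
    (fun i => re_b_pos hKx hKy (thetaP_mem hN i)) (fun j => re_b_pos hKx hKy (thetaA_mem hN j))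
  have hP : IsUnit (diagonal fun i : Fin N => Complex.exp (-(I * ((l - 1 / 2) * thetaP N i))) *
      Complex.exp (-(I * thetaP N i / 2)) / rootB Kx Ky (thetaP N i)) := by
    rw [Matrix.isUnit_diagonal, Pi.isUnit_iff]
    exact fun i => (div_ne_zero (mul_ne_zero (Complex.exp_ne_zero _) (Complex.exp_ne_zero _))
      (rootB_ne_zero hKx hKy _)).isUnit
  -- The constant is `-i/(2iN) = -1/(2N)`, from the prefactor of `D` and the `-i` of `inv_sin_eq`.
  have hA : IsUnit (diagonal fun j : Fin N => -(2 * N : ℂ)⁻¹ *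
      (Complex.exp (I * ((l - 1 / 2) * thetaA N j)) *
      Complex.exp (I * thetaA N j / 2) / rootB Kx Ky (thetaA N j))) := by
    rw [Matrix.isUnit_diagonal, Pi.isUnit_iff]
    exact fun i => (mul_ne_zero (neg_ne_zero.2 (inv_ne_zero (mul_ne_zero two_ne_zero hN')))
      (div_ne_zero (mul_ne_zero (Complex.exp_ne_zero _) (Complex.exp_ne_zero _))
      (rootB_ne_zero hKx hKy _))).isUnit
  convert (hP.mul h).mul hA using 1
  ext i j
  rw [Matrix.mul_diagonal, Matrix.diagonal_mul, Matrix.add_apply, Matrix.diagonal_mul,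
    Matrix.mul_diagonal, matD, Matrix.of_apply]
  have e1 : Complex.exp (-(I * ((l - 1 / 2) * (thetaP N i - thetaA N j)))) =
      Complex.exp (-(I * ((l - 1 / 2) * thetaP N i))) *
        Complex.exp (I * ((l - 1 / 2) * thetaA N j)) := by
    rw [← Complex.exp_add]; congr 1; ring
  have e2 : Complex.exp (I * (thetaA N j - thetaP N i) / 2) =
      Complex.exp (-(I * thetaP N i / 2)) * Complex.exp (I * thetaA N j / 2) := by
    rw [← Complex.exp_add]; congr 1; ring
  simp only []
  rw [sqrt_b_div_add hKx hKy (thetaP_mem hN i) (thetaA_mem hN j), div_eq_mul_inv, mul_inv,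
    inv_sin_eq hN, e1, e2]
  have h1 := rootB_ne_zero hKx hKy (thetaP N i)
  have h2 := rootB_ne_zero hKx hKy (thetaA N j)
  have h3 := I_ne_zero
  field_simp

theorem matD_eq : matD Kx Ky N l = (I * Real.sinh (2 * Ky) / N) •
    (conjMat (lamP Kx Ky N l) * matPhi Kx Ky N * lamA Kx Ky N l) := by
  ext i j
  rw [lamP, lamA, conjMat_matLam, matLam, Matrix.smul_apply, Matrix.mul_diagonal,
    Matrix.diagonal_mul, smul_eq_mul, matD, Matrix.of_apply, matPhi, Matrix.of_apply]
  have e1 : Complex.exp (-(I * ((l - 1 / 2) * (thetaP N i - thetaA N j)))) =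
      Complex.exp (-(I * ((l - 1 / 2) * thetaP N i))) *
        Complex.exp (I * ((l - 1 / 2) * thetaA N j)) := by
    rw [← Complex.exp_add]; congr 1; ring
  have hker := sum_kernel hKx hKy (thetaP_mem hN i) (thetaA_mem hN j)
  rw [Real.sqrt_mul (sinh_gam_pos_of_mem hKx hKy (thetaP_mem hN i)).le] at hker
  have hs : Real.sin ((thetaA N j - thetaP N i) / 2) = -Real.sin ((thetaP N i - thetaA N j) / 2) := by
    rw [← Real.sin_neg]; congr 1; ring
  simp only []
  rw [e1, hs, add_comm (Complex.sqrt _)]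
  generalize Complex.sqrt (b Kx Ky (thetaP N i) / b Kx Ky (thetaA N j)) +
    Complex.sqrt (b Kx Ky (thetaA N j) / b Kx Ky (thetaP N i)) = t at *
  push_cast at hker ⊢
  have e3 : ∀ p q s : ℂ, p * q / (2 * I * N * -s) * t = p * q * (I / N) * (1 / (2 * s) * t) := by
    intro p q s
    rw [show (2 * I * N * -s) = (2 * s) * (-I * N) by ring, div_mul_eq_div_div, one_div,
      div_eq_mul_inv _ (2 * s), div_eq_mul_inv _ (-I * N), mul_inv, mul_inv (-I), inv_neg, Complex.inv_I, neg_neg]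
    ring
  rw [e3, hker]
  ring

theorem matC_eq : matC Kx Ky N l = (-(Real.sinh (2 * dual Kx) / N : ℂ)) •
    (conjMat (lamP Kx Ky N l) * matPsi Kx Ky N * conjMat (lamA Kx Ky N l)) := by
  ext i j
  rw [lamP, lamA, conjMat_matLam, conjMat_matLam, Matrix.smul_apply, Matrix.mul_diagonal,
    Matrix.diagonal_mul, smul_eq_mul, matC, Matrix.of_apply, matPsi, Matrix.of_apply]
  have e1 : Complex.exp (-(I * ((l - 1 / 2) * (thetaP N i + thetaA N j)))) =
      Complex.exp (-(I * ((l - 1 / 2) * thetaP N i))) *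
        Complex.exp (-(I * ((l - 1 / 2) * thetaA N j))) := by
    rw [← Complex.exp_add]; congr 1; ring
  have hker := difference_kernel hKx hKy (thetaP_mem hN i) (thetaA_mem hN j)
    (by linarith [(thetaP_mem hN i).1, thetaA_pos hN j] |> fun h : 0 < _ => h.ne')
    (thetaP_add_thetaA_ne hN i j)
  rw [Real.sqrt_mul (sinh_gam_pos_of_mem hKx hKy (thetaP_mem hN i)).le] at hker
  simp only []
  rw [e1]
  generalize Complex.sqrt (b Kx Ky (thetaP N i) * b Kx Ky (thetaA N j)) -
    1 / Complex.sqrt (b Kx Ky (thetaP N i) * b Kx Ky (thetaA N j)) = t at *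
  push_cast at hker ⊢
  have e3 : ∀ p q s : ℂ, p * q / (2 * I * N * s) * t = p * q * (-I / N) * (1 / (2 * s) * t) := by
    intro p q s
    rw [show (2 * I * N * s) = (2 * s) * (I * N) by ring, div_mul_eq_div_div, one_div,
      div_eq_mul_inv _ (2 * s), div_eq_mul_inv _ (I * N), mul_inv, mul_inv I, Complex.inv_I]
    ring
  rw [e3, hker]
  ring_nf
  simp only [I_sq]
  ring

theorem matB_eq : matB Kx Ky N l = (-(Real.sinh (2 * dual Kx) / N : ℂ)) •
    (lamP Kx Ky N l * matPsi Kx Ky N * lamA Kx Ky N l) := by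
  have hpsi : conjMat (matPsi Kx Ky N) = matPsi Kx Ky N := by
    ext i j; simp [conjMat, matPsi]
  have hsm : ∀ (x : ℝ) (M : Matrix (Fin N) (Fin N) ℂ),
      conjMat ((-(x / N : ℂ)) • M) = (-(x / N : ℂ)) • conjMat M := by
    intro x M; ext i j; simp [conjMat]
  rw [matB, matC_eq hKx hKy hN, hsm, conjMat_mul, conjMat_mul, conjMat_conjMat, conjMat_conjMat, hpsi]

end Matrices

end Ising

end

/-! ### Inverse, products and determinant -/

theorem mainTheorem3 (Kx Ky : ℝ) (hKx : 0 < Kx) (hKy : dual Kx < Ky)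
    (N : ℕ) (hN : 0 < N) (l : ℤ) :
    -- the elliptic parameters are well defined
    (∃! η : ℝ, IsEta Kx Ky η) ∧
    (∀ θ ∈ Set.Ico (0 : ℝ) (2 * Real.pi), ∃! u : ℝ, IsU Kx Ky θ u) ∧
    -- elliptic form of the trigonometric kernels
    (∀ θ ∈ Set.Ico (0 : ℝ) (2 * Real.pi), ∀ θ' ∈ Set.Ico (0 : ℝ) (2 * Real.pi),
      θ ≠ θ' → θ + θ' ≠ 0 → θ + θ' ≠ 2 * Real.pi →
      1 / (2 * Real.sin ((θ - θ') / 2)) *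
          (Complex.sqrt (b Kx Ky θ / b Kx Ky θ') + Complex.sqrt (b Kx Ky θ' / b Kx Ky θ)) =
        Real.sinh (2 * Ky) / Real.sqrt (Real.sinh (gam Kx Ky θ) * Real.sinh (gam Kx Ky θ')) *
          (dn (modulus Kx Ky) (uu Kx Ky θ - uu Kx Ky θ') /
            sn (modulus Kx Ky) (uu Kx Ky θ - uu Kx Ky θ')) ∧
      1 / (2 * Real.sin ((θ + θ') / 2)) *
          (Complex.sqrt (b Kx Ky θ * b Kx Ky θ') - 1 / Complex.sqrt (b Kx Ky θ * b Kx Ky θ')) =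
        -Complex.I * Real.sinh (2 * dual Kx) /
          Real.sqrt (Real.sinh (gam Kx Ky θ) * Real.sinh (gam Kx Ky θ')) *
          cn (modulus Kx Ky) (uu Kx Ky θ - uu Kx Ky θ')) ∧
    -- `D` and `Φ` are invertible
    IsUnit (matD Kx Ky N l) ∧ IsUnit (matPhi Kx Ky N) ∧
    (matD Kx Ky N l)⁻¹ =
      (-Complex.I * N / Real.sinh (2 * Ky)) •
        ((lamA Kx Ky N l)⁻¹ * (matPhi Kx Ky N)⁻¹ * (conjMat (lamP Kx Ky N l))⁻¹) ∧
    matB Kx Ky N l * (matD Kx Ky N l)⁻¹ =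
      (Complex.I * (Real.sinh (2 * dual Kx) / Real.sinh (2 * Ky))) •
        (lamP Kx Ky N l * matPsi Kx Ky N * (matPhi Kx Ky N)⁻¹ * (conjMat (lamP Kx Ky N l))⁻¹) ∧
    (matD Kx Ky N l)⁻¹ * matC Kx Ky N l =
      (Complex.I * (Real.sinh (2 * dual Kx) / Real.sinh (2 * Ky))) •
        ((lamA Kx Ky N l)⁻¹ * (matPhi Kx Ky N)⁻¹ * matPsi Kx Ky N * conjMat (lamA Kx Ky N l)) ∧
    ‖(matD Kx Ky N l).det‖ =
      Real.sinh (2 * Ky) ^ N * ‖(matPhi Kx Ky N).det‖ /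
        ((N : ℝ) ^ N * Real.sqrt ((∏ j, Real.sinh (gam Kx Ky (thetaP N j))) *
          ∏ j, Real.sinh (gam Kx Ky (thetaA N j)))) := by
  have hpP : ∀ j, 0 < Real.sinh (gam Kx Ky (thetaP N j)) :=
    fun j => sinh_gam_pos_of_mem hKx hKy (thetaP_mem hN j)
  have hpA : ∀ j, 0 < Real.sinh (gam Kx Ky (thetaA N j)) :=
    fun j => sinh_gam_pos_of_mem hKx hKy (thetaA_mem hN j)
  have hN' : (N : ℂ) ≠ 0 := by exact_mod_cast hN.ne'
  have hsy : 0 < Real.sinh (2 * Ky) := Real.sinh_pos_iff.2 (by linarith [dual_pos hKx])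
  have hsy' : (Real.sinh (2 * Ky) : ℂ) ≠ 0 := Complex.ofReal_ne_zero.2 hsy.ne'
  have hD := matD_eq hKx hKy hN l
  have hC := matC_eq hKx hKy hN l
  have hB := matB_eq hKx hKy hN l
  have hDu := isUnit_matD hKx hKy hN l
  have hA : IsUnit (lamA Kx Ky N l).det := isUnit_det_matLam l hpA
  have hP : IsUnit (conjMat (lamP Kx Ky N l)).det := by
    rw [det_conjMat]; exact (isUnit_det_matLam l hpP).map (starRingEnd ℂ)
  have hdet := congrArg Matrix.det hD
  rw [Matrix.det_smul, Matrix.det_mul, Matrix.det_mul, Fintype.card_fin] at hdet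
  -- Invertibility passes from `D` to `Φ`: its determinant is a factor of the nonzero determinant of
  -- `D`.
  have hPhi : IsUnit (matPhi Kx Ky N).det := by
    have h0 := ((Matrix.isUnit_iff_isUnit_det _).1 hDu).ne_zero
    rw [hdet] at h0
    exact (right_ne_zero_of_mul (left_ne_zero_of_mul (right_ne_zero_of_mul h0))).isUnit
  have hDinv : (matD Kx Ky N l)⁻¹ = (-Complex.I * N / Real.sinh (2 * Ky)) •
      ((lamA Kx Ky N l)⁻¹ * (matPhi Kx Ky N)⁻¹ * (conjMat (lamP Kx Ky N l))⁻¹) := by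
    refine Matrix.inv_eq_right_inv ?_
    have e : Complex.I * Real.sinh (2 * Ky) / N * (-Complex.I * N / Real.sinh (2 * Ky)) = 1 := by
      field_simp
      rw [Complex.I_sq, neg_neg]
    rw [hD, Matrix.smul_mul, Matrix.mul_smul, smul_smul, e, one_smul, Matrix.mul_assoc,
      ← Matrix.mul_assoc (lamA Kx Ky N l), ← Matrix.mul_assoc (lamA Kx Ky N l),
      Matrix.mul_nonsing_inv _ hA, Matrix.one_mul, Matrix.mul_assoc,
      ← Matrix.mul_assoc (matPhi Kx Ky N), Matrix.mul_nonsing_inv _ hPhi, Matrix.one_mul,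
      Matrix.mul_nonsing_inv _ hP]
  refine ⟨existsUnique_isEta hKx hKy, fun θ hθ => existsUnique_isU hKx hKy hθ,
    fun θ hθ θ' hθ' _ h₀ h₁ => ⟨sum_kernel hKx hKy hθ hθ', difference_kernel hKx hKy hθ hθ' h₀ h₁⟩,
    hDu, (Matrix.isUnit_iff_isUnit_det _).2 hPhi, hDinv, ?_, ?_, ?_⟩
  · rw [hDinv, hB, Matrix.smul_mul, Matrix.mul_smul, smul_smul]
    congr 1
    · field_simp
    · rw [Matrix.mul_assoc, ← Matrix.mul_assoc (lamA Kx Ky N l), ← Matrix.mul_assoc (lamA Kx Ky N l),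
        Matrix.mul_nonsing_inv _ hA, Matrix.one_mul]
      simp only [Matrix.mul_assoc]
  · rw [hDinv, hC, Matrix.smul_mul, Matrix.mul_smul, smul_smul]
    congr 1
    · field_simp
    · rw [Matrix.mul_assoc, ← Matrix.mul_assoc (conjMat (lamP Kx Ky N l))⁻¹,
        ← Matrix.mul_assoc (conjMat (lamP Kx Ky N l))⁻¹, Matrix.nonsing_inv_mul _ hP, Matrix.one_mul]
      simp only [Matrix.mul_assoc]
  · rw [hdet, norm_mul, norm_mul, norm_mul, det_conjMat, RCLike.norm_conj, lamP, lamA,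
      norm_det_matLam l hpP, norm_det_matLam l hpA, norm_pow, norm_div, norm_mul, Complex.norm_I,
      Complex.norm_real, Real.norm_of_nonneg hsy.le, Complex.norm_natCast, one_mul, div_pow,
      Real.sqrt_mul (Finset.prod_nonneg fun j _ => (hpP j).le)]
    simp only [div_eq_mul_inv, mul_inv]
    ring
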